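/- Let $m\ge 4$ be an even integer. Identify $\mathbb F_{2^{2m}}$ with $\mathbb F_{2^m}\times\mathbb F_{2^m}$ by any fixed $\mathbb F_2$-linear bijection. For integers $0\le k,s\le m$ with $\gcd(k,m)=1$ and $s$ even, and for a non-cube $\alpha\in\mathbb F_{2^m}^*$, the function on $\mathbb F_{2^{2m}}$ given in this identification by $$f_{k,s,\alpha}(x,y)=\left(x^{2^k+1}+\alpha\, y^{(2^k+1)2^s},\ xy\right)$$ is called a Pott–Zhou function. A function $f$ on $\mathbb F_{2^n}$ is called almost perfect nonlinear (APN) if for all $a,b\in\mathbb F_{2^n}$ with $a\ne 0$ the equation $f(x+a)+f(x)=b$ has exactly $0$ or $2$ solutions $x\in\mathbb F_{2^n}$. Two functions $f,g$ on $\mathbb F_{2^n}$ are called CCZ-equivalent if there is a permutation of $\mathbb F_{2^n}\times\mathbb F_{2^n}$, affine over $\mathbb F_2$, that maps the graph $\{(x,f(x)):x\in\mathbb F_{2^n}\}$ onto the graph $\{(x,g(x)):x\in\mathbb F_{2^n}\}$. Then there exist $$\left(\left\lfloor\frac m4\right\rfloor+1\right)\frac{\varphi(m)}2$$ pairwise CCZ-inequivalent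 Pott–Zhou functions on $\mathbb F_{2^{2m}}$ that are APN, where $\varphi$ is Euler's totient function. Consequently, the number of CCZ-equivalence classes of APN functions on $\mathbb F_{2^{2m}}$ is at least $\left(\left\lfloor\frac m4\right\rfloor+1\right)\frac{\varphi(m)}2$. -/

import Mathlib

/-- A self-map `f` of an `𝔽₂`-vector space is almost perfect nonlinear (APN) if, for all `a ≠ 0`
and all `b`, the equation `f (x + a) + f x = b` has exactly `0` or `2` solutions `x`. -/
def IsAPN {V : Type*} [AddCommGroup V] (f : V → V) : Prop :=
  ∀ a b : V, a ≠ 0 →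
    {x : V | f (x + a) + f x = b}.encard = 0 ∨ {x : V | f (x + a) + f x = b}.encard = 2

/-- Two self-maps of an `𝔽₂`-vector space `V` are CCZ-equivalent if some affine permutation of
`V × V` (affine over `𝔽₂`) maps the graph of the first onto the graph of the second. -/
def CCZEquivalent {V : Type*} [AddCommGroup V] [Module (ZMod 2) V] (f g : V → V) : Prop :=
  ∃ C : (V × V) ≃ᵃ[ZMod 2] (V × V),
    C '' Set.range (fun x : V => (x, f x)) = Set.range (fun x : V => (x, g x))

theorem CCZEquivalent.refl {V : Type*} [AddCommGroup V] [Module (ZMod 2) V] (f : V → V) :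
    CCZEquivalent f f :=
  ⟨AffineEquiv.refl (ZMod 2) (V × V), by simp⟩

theorem CCZEquivalent.symm {V : Type*} [AddCommGroup V] [Module (ZMod 2) V] {f g : V → V}
    (h : CCZEquivalent f g) : CCZEquivalent g f := by
  obtain ⟨C, hC⟩ := h
  refine ⟨C.symm, ?_⟩
  rw [← hC, Set.image_image]
  simp

theorem CCZEquivalent.trans {V : Type*} [AddCommGroup V] [Module (ZMod 2) V] {f g h : V → V}
    (hfg : CCZEquivalent f g) (hgh : CCZEquivalent g h) : CCZEquivalent f h := by
  obtain ⟨C, hC⟩ := hfg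
  obtain ⟨D, hD⟩ := hgh
  refine ⟨C.trans D, ?_⟩
  rw [← hD, ← hC, Set.image_image]
  rfl

/-- CCZ-equivalence as an equivalence relation on the set of APN functions on `V`. -/
def apnSetoid (V : Type*) [AddCommGroup V] [Module (ZMod 2) V] :
    Setoid {f : V → V // IsAPN f} where
  r f g := CCZEquivalent f.1 g.1
  iseqv := ⟨fun f => CCZEquivalent.refl f.1, fun h => h.symm, fun h₁ h₂ => h₁.trans h₂⟩

/-- The number of CCZ-equivalence classes of APN functions on `V`. -/
noncomputable def numAPNClasses (V : Type*) [AddCommGroup V] [Module (ZMod 2) V] : ℕ :=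
  Nat.card (Quotient (apnSetoid V))

/-- The bivariate map `f_{k,s,α}(x, y) = (x^(2^k+1) + α y^((2^k+1) 2^s), x y)`. -/
def pottZhou {F : Type*} [Field F] (k s : ℕ) (α : F) (p : F × F) : F × F :=
  (p.1 ^ (2 ^ k + 1) + α * p.2 ^ ((2 ^ k + 1) * 2 ^ s), p.1 * p.2)

/-- The Pott–Zhou APN functions on `K = 𝔽_{2^{2m}}`, where `F = 𝔽_{2^m}` and `K` is identified
with `F × F` by the `𝔽₂`-linear bijection `e`: the maps that become `f_{k,s,α}` on `F × F`, with
`0 ≤ k, s ≤ m`, `k` coprime to `m`, `s` even, and `α ∈ F^*` a non-cube. -/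
def IsPottZhou {F K : Type*} [Field F] [Field K] [Algebra (ZMod 2) F] [Algebra (ZMod 2) K]
    (m : ℕ) (e : (F × F) ≃ₗ[ZMod 2] K) (f : K → K) : Prop :=
  ∃ (k s : ℕ) (α : F), k ≤ m ∧ s ≤ m ∧ Nat.Coprime k m ∧ Even s ∧
    α ≠ 0 ∧ (¬ ∃ β : F, β ^ 3 = α) ∧ ∀ z : K, f z = e (pottZhou k s α (e.symm z))

/-!
A CCZ-equivalence between the graphs of two Pott–Zhou functions `f` and `g` is shown to come from
a linear equivalence of their polar forms, and the coefficients of such an equivalence, written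
with linearized polynomials, determine the parameters `k` and `s`.

**From CCZ-equivalence to linear equivalence.** Both functions are quadratic, so the equivalence
can be normalised to a linear map whose first component gives a permutation `F x = A x + C (f x)`
such that `g ∘ F` is again quadratic. Write `H = C ∘ B` for the polar form of `F`, where `B` is
that of `f`. If `c` is a common zero of `H a` and `H b`, then the third derivative of `g ∘ F`
shows that `F c` and `H a b` are orthogonal for the polar form of `g`, so that `H a b ∈ {0, F c}`
by the APN property; hence `H a b = 0` as soon as the kernels of `H a` and `H b` share two nonzero
vectors (`polar_eq_zero_of_common_kernel`). Components of `F` are balanced, and balanced quadratic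
forms are degenerate. As the components `x * y` of `f` are bent, `C` has rank at most `m`, half of
the dimension. If the rank is smaller than `m`, all kernels are large enough, so `H = 0` and
`C = 0`. If it equals `m`, the `2 ^ m - 1` nonzero degenerate components `θ ∘ H` have pairwise
disjoint radicals, up to `0`, with at least three nonzero vectors each, all of which lie in a
single kernel of
dimension `m + 1`: there are too many of them. Thus `C = 0` (`exists_polar_equiv_of_ccz`).

**From linear equivalence to equality of parameters.** Let
`(x, y) ↦ ∑ A_i x ^ (2 ^ i) + D_i y ^ (2 ^ i)` be the linear map, with `A_i, D_i ∈ F × F`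
and `i ∈ ZMod m`. Comparing coefficients in the component `x * y` shows that `A_i` and `D_j` are
proportional for `i ≠ j`, as are `A_i` and
`A_j`, or `D_i` and `D_j`, unless `i - j = ± k`. So some pair `A_o, D_o` is independent, and only
the indices `o`, `o ± k` occur. The mixed terms of the other component eliminate `o ± k`
(`coeff_eq_zero`): possible cancellations are excluded by the parity of the indices (`m, s, t` are
even, `k, l` odd), or because the constant of `g` is not a cube. The map is then monomial, and its
coefficients give `k = l` and `s = ± t` (`index_eq_of_coeff`).
-/

/-! ### Quadratic maps and character sums over `𝔽₂` -/

section Quadratic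

open Module

variable {V W : Type*} [AddCommGroup V] [Module (ZMod 2) V] [AddCommGroup W] [Module (ZMod 2) W]

/-- `B` is the polar form of `f`. As `B` is bilinear, this says that `f` is quadratic and vanishes
at `0`. -/
def HasPolar (f : V → W) (B : V →ₗ[ZMod 2] V →ₗ[ZMod 2] W) : Prop :=
  ∀ x y, f (x + y) = f x + f y + B x y

/-- The kernel condition on the polar form that characterises quadratic APN functions: for `a ≠ 0`
the kernel of `B a` is `{0, a}`. -/
def IsAPNForm (B : V →ₗ[ZMod 2] V →ₗ[ZMod 2] W) : Prop :=
  ∀ a b, B a b = 0 → a = 0 ∨ b = 0 ∨ b = a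

theorem HasPolar.map_zero {f : V → W} {B : V →ₗ[ZMod 2] V →ₗ[ZMod 2] W} (hf : HasPolar f B) :
    f 0 = 0 := by
  have h := hf 0 0
  simp only [ZModModule.add_self, _root_.map_zero] at h
  exact h

theorem HasPolar.apply_self {f : V → W} {B : V →ₗ[ZMod 2] V →ₗ[ZMod 2] W} (hf : HasPolar f B)
    (x : V) : B x x = 0 := by
  have h := hf x x
  rw [ZModModule.add_self, ZModModule.add_self, hf.map_zero, zero_add] at h
  exact h.symm

theorem HasPolar.comp {X : Type*} [AddCommGroup X] [Module (ZMod 2) X] {f : V → W}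
    {B : V →ₗ[ZMod 2] V →ₗ[ZMod 2] W} (hf : HasPolar f B) (ψ : W →ₗ[ZMod 2] X) :
    HasPolar (fun x => ψ (f x)) (B.compr₂ ψ) := fun x y => by simp [hf x y]

theorem HasPolar.add_linear {f : V → W} {B : V →ₗ[ZMod 2] V →ₗ[ZMod 2] W} (hf : HasPolar f B)
    (l : V →ₗ[ZMod 2] W) : HasPolar (fun x => f x + l x) B := fun x y => by
  simp only [hf x y, map_add]; abel

theorem HasPolar.isAPN {f : V → V} {B : V →ₗ[ZMod 2] V →ₗ[ZMod 2] V} (hf : HasPolar f B)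
    (hB : IsAPNForm B) : IsAPN f := by
  intro a b ha
  have key : ∀ x, f (x + a) + f x = f a + B a x := fun x => by
    rw [add_comm x a, hf a x]
    have h2 := ZModModule.add_self (f x)
    calc f a + f x + B a x + f x = f a + B a x + (f x + f x) := by abel
      _ = f a + B a x := by rw [h2, add_zero]
  by_cases hex : ∃ x₀, f (x₀ + a) + f x₀ = b
  · right
    obtain ⟨x₀, hx₀⟩ := hex
    have : {x : V | f (x + a) + f x = b} = {x₀, x₀ + a} := by
      ext x
      simp only [Set.mem_ofPred_eq, Set.mem_insert_iff, Set.mem_singleton_iff]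
      rw [key] at hx₀ ⊢
      rw [← hx₀, add_right_inj]
      constructor
      · intro h
        have h0 : B a (x - x₀) = 0 := by rw [map_sub, h, sub_self]
        rcases hB _ _ h0 with h1 | h1 | h1
        · exact absurd h1 ha
        · exact Or.inl (sub_eq_zero.1 h1)
        · exact Or.inr (by rw [← h1]; abel)
      · rintro (rfl | rfl)
        · rfl
        · rw [map_add, hf.apply_self, add_zero]
    rw [this, Set.encard_pair]
    intro h
    exact ha (by simpa using h.symm)
  · left
    rw [Set.encard_eq_zero]
    ext x
    simp only [Set.mem_ofPred_eq, Set.mem_empty_iff_false, iff_false]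
    exact fun h => hex ⟨x, h⟩

/-- The nontrivial character of `𝔽₂`, with values in `ℤ`. -/
def signChar (z : ZMod 2) : ℤ := if z = 0 then 1 else -1

theorem signChar_add : ∀ y z, signChar (y + z) = signChar y * signChar z := by decide

theorem signChar_zero : signChar 0 = 1 := rfl

theorem signChar_mul_self : ∀ z, signChar z * signChar z = 1 := by decide

theorem sum_signChar_eq_zero [Fintype V] (l : V →ₗ[ZMod 2] ZMod 2) (hl : l ≠ 0) :
    ∑ x, signChar (l x) = 0 := by
  obtain ⟨b, hb⟩ : ∃ b, l b ≠ 0 := by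
    by_contra! h
    exact hl (LinearMap.ext h)
  have h1 : l b = 1 := by
    revert hb; generalize l b = z; revert z; decide
  have h2 : ∑ x, signChar (l x) = ∑ x, signChar (l (x + b)) :=
    (Equiv.sum_comp (Equiv.addRight b) fun x => signChar (l x)).symm
  have h3 : ∀ x, signChar (l (x + b)) = - signChar (l x) := fun x => by
    rw [map_add, h1]; generalize l x = z; revert z; decide
  simp only [h3, Finset.sum_neg_distrib] at h2
  linarith

open Classical in
/-- The square of the exponential sum of a quadratic form is determined by the values of the form
on the radical of its polar form. -/
theorem sq_sum_signChar [Fintype V] {Q : V → ZMod 2} {β : V →ₗ[ZMod 2] V →ₗ[ZMod 2] ZMod 2}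
    (hQ : HasPolar Q β) :
    (∑ x, signChar (Q x)) ^ 2 =
      Fintype.card V * ∑ a, if β a = 0 then signChar (Q a) else 0 := by
  have h1 : (∑ x, signChar (Q x)) ^ 2 = ∑ x, ∑ a, signChar (Q a) * signChar (β a x) := by
    rw [sq, Finset.sum_mul_sum]
    refine Finset.sum_congr rfl fun x _ => ?_
    rw [← Equiv.sum_comp (Equiv.addRight x)]
    refine Finset.sum_congr rfl fun a _ => ?_
    rw [Equiv.coe_addRight, hQ a x, signChar_add, signChar_add]
    linear_combination (signChar (Q a) * signChar (β a x)) * signChar_mul_self (Q x)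
  rw [h1, Finset.sum_comm, Finset.mul_sum]
  refine Finset.sum_congr rfl fun a _ => ?_
  rw [← Finset.mul_sum]
  split_ifs with h
  · simp [h, signChar_zero, mul_comm]
  · rw [sum_signChar_eq_zero _ h, mul_zero, mul_zero]

/-- A balanced quadratic form has a degenerate polar form. -/
theorem exists_radical_of_sum_eq_zero [Fintype V] {Q : V → ZMod 2}
    {β : V →ₗ[ZMod 2] V →ₗ[ZMod 2] ZMod 2} (hQ : HasPolar Q β) (h0 : ∑ x, signChar (Q x) = 0) :
    ∃ a ≠ 0, β a = 0 := by
  classical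
  by_contra! h
  have h1 := sq_sum_signChar hQ
  rw [h0, Finset.sum_eq_single 0] at h1
  · simp only [_root_.map_zero, if_true, hQ.map_zero, signChar_zero] at h1
    have : 0 < Fintype.card V := Fintype.card_pos
    simp at h1
    exact this.ne' (by exact_mod_cast h1.symm)
  · intro a _ ha
    rw [if_neg (h a ha)]
  · simp

/-- In even dimension, the radical of the polar form of a quadratic form does not have exactly two
elements. -/
theorem four_le_card_radical [Fintype V] {m : ℕ} (hV : finrank (ZMod 2) V = 2 * m) {Q : V → ZMod 2}
    {β : V →ₗ[ZMod 2] V →ₗ[ZMod 2] ZMod 2} (hQ : HasPolar Q β) {a : V} (ha : a ≠ 0)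
    (hβ : β a = 0) : 4 ≤ Nat.card (LinearMap.ker β) := by
  classical
  have hpow : Nat.card (LinearMap.ker β) = 2 ^ finrank (ZMod 2) (LinearMap.ker β) := by
    rw [Module.natCard_eq_pow_finrank (K := ZMod 2), Nat.card_zmod]
  rw [hpow]
  suffices 2 ≤ finrank (ZMod 2) (LinearMap.ker β) from
    (Nat.pow_le_pow_right (by norm_num) this : 2 ^ 2 ≤ _)
  by_contra! hlt
  have hker : ∀ x, β x = 0 → x = 0 ∨ x = a := by
    intro x hx
    by_contra! hne
    have h3 : ({⟨0, by simp⟩, ⟨a, hβ⟩, ⟨x, hx⟩} : Finset (LinearMap.ker β)).card = 3 := by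
      rw [Finset.card_eq_three]
      exact ⟨_, _, _, fun h => ha.symm (congrArg Subtype.val h),
        fun h => hne.1.symm (congrArg Subtype.val h),
        fun h => hne.2.symm (congrArg Subtype.val h), rfl⟩
    have h4 := Finset.card_le_univ ({⟨0, by simp⟩, ⟨a, hβ⟩, ⟨x, hx⟩} : Finset (LinearMap.ker β))
    rw [h3, ← Nat.card_eq_fintype_card, hpow] at h4
    have : 2 ^ finrank (ZMod 2) (LinearMap.ker β) ≤ 2 ^ 1 :=
      Nat.pow_le_pow_right (by norm_num) (by omega)
    omega
  -- after adding a linear form, `Q` vanishes at `a`, and then its sum has square `2 ^ (2 * m + 1)`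
  obtain ⟨l, hl⟩ : ∃ l : V →ₗ[ZMod 2] ZMod 2, Q a + l a = 0 := by
    obtain ⟨l, hl⟩ := Module.Projective.exists_dual_eq_one (ZMod 2) ha
    exact ⟨Q a • l, by simp [hl, ZModModule.add_self]⟩
  have h1 := sq_sum_signChar (hQ.add_linear l)
  have h2 : (∑ x, if β x = 0 then signChar (Q x + l x) else 0) = 2 := by
    rw [Finset.sum_eq_add 0 a ha.symm]
    · simp [hβ, hl, hQ.map_zero, signChar_zero]
    · rintro x - ⟨hx0, hxa⟩
      exact if_neg fun h => (hker x h).elim hx0 hxa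
    · simp
    · simp
  have hcard : Fintype.card V = 2 ^ (2 * m) := by
    rw [← Nat.card_eq_fintype_card, Module.natCard_eq_pow_finrank (K := ZMod 2), Nat.card_zmod, hV]
  rw [h2, hcard] at h1
  have h5 : (∑ x, signChar (Q x + l x)).natAbs ^ 2 = 2 ^ (2 * m + 1) := by
    zify
    rw [sq_abs, h1]; push_cast; ring
  obtain ⟨j, -, hj⟩ := (Nat.dvd_prime_pow Nat.prime_two).1
    (Dvd.intro_left _ (by rw [← h5, sq]) : (∑ x, signChar (Q x + l x)).natAbs ∣ 2 ^ (2 * m + 1))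
  rw [hj, ← pow_mul] at h5
  have := Nat.pow_right_injective le_rfl h5
  omega

end Quadratic

/-! ### CCZ-equivalence of quadratic APN maps -/

section CCZ

open Module

variable {V : Type*} [AddCommGroup V] [Module (ZMod 2) V]

/-- A CCZ-equivalence to a quadratic map can be made linear: the translations
`(x, y) ↦ (x + c, y + g (x + c) + g x)` of the graph of `g` are affine and act
transitively on it. -/
theorem exists_linear_of_ccz {f g : V → V} {B' : V →ₗ[ZMod 2] V →ₗ[ZMod 2] V} (hf : f 0 = 0)
    (hg : HasPolar g B') (h : CCZEquivalent f g) :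
    ∃ L₁ L₂ : V × V →ₗ[ZMod 2] V, Function.Bijective (fun x => L₁ (x, f x)) ∧
      ∀ x, g (L₁ (x, f x)) = L₂ (x, f x) := by
  obtain ⟨C, hC⟩ := h
  have hdec : ∀ p, C p = C.linear p + C 0 := fun p => by
    have := C.map_vadd 0 p
    simpa using this
  have hmem : ∀ x, (C (x, f x)).2 = g (C (x, f x)).1 := fun x => by
    have : C (x, f x) ∈ Set.range (fun x : V => (x, g x)) := hC ▸ ⟨_, ⟨x, rfl⟩, rfl⟩
    obtain ⟨y, hy⟩ := this
    rw [← hy]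
  have h0 := hmem 0
  rw [hf, Prod.mk_zero_zero] at h0
  set c := (C 0).1 with hc
  let L₁ : V × V →ₗ[ZMod 2] V := LinearMap.fst _ _ _ ∘ₗ C.linear.toLinearMap
  let L₂ : V × V →ₗ[ZMod 2] V := LinearMap.snd _ _ _ ∘ₗ C.linear.toLinearMap + B' c ∘ₗ L₁
  have hfst : ∀ p, (C p).1 = c + L₁ p := fun p => by
    rw [hdec p, add_comm]; rfl
  refine ⟨L₁, L₂, ⟨fun x y hxy => ?_, fun y => ?_⟩, fun x => ?_⟩
  · have h1 : (C (x, f x)).1 = (C (y, f y)).1 := by rw [hfst, hfst]; exact congrArg _ hxy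
    have h2 : C (x, f x) = C (y, f y) := Prod.ext h1 (by rw [hmem, hmem, h1])
    exact congrArg Prod.fst (C.injective h2)
  · have : (c + y, g (c + y)) ∈ C '' Set.range (fun x : V => (x, f x)) := hC ▸ ⟨c + y, rfl⟩
    obtain ⟨_, ⟨x, rfl⟩, hx⟩ := this
    refine ⟨x, ?_⟩
    have := hfst (x, f x)
    rw [hx] at this
    exact (add_left_cancel this).symm
  · have h1 := hmem x
    rw [hfst, hg, hdec, Prod.snd_add, h0] at h1
    have h3 := ZModModule.add_self (B' c (L₁ (x, f x)))
    change _ = (C.linear (x, f x)).2 + B' c (L₁ (x, f x))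
    calc g (L₁ (x, f x)) = (g c + g (L₁ (x, f x)) + B' c (L₁ (x, f x))) - g c
          + B' c (L₁ (x, f x)) - (B' c (L₁ (x, f x)) + B' c (L₁ (x, f x))) := by abel
      _ = _ := by rw [← h1, h3]; abel

variable {f g : V → V} {B B' : V →ₗ[ZMod 2] V →ₗ[ZMod 2] V}

/-- If `F (a + b) = F a + F b + H (a, b)` and `g ∘ F` is quadratic, then a common zero `c` of
`H (a, ·)` and `H (b, ·)` forces `H (a, b) ∈ {0, F c}`; two such `c` force `H (a, b) = 0`. -/
theorem polar_eq_zero_of_common_kernel {H : V →ₗ[ZMod 2] V →ₗ[ZMod 2] V} {F : V → V}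
    (hF : HasPolar F H) (hinj : Function.Injective F) (hg : HasPolar g B') (hB' : IsAPNForm B')
    {G : V →ₗ[ZMod 2] V →ₗ[ZMod 2] V} (hG : HasPolar (fun x => g (F x)) G) {a b c c' : V}
    (hc : c ≠ 0) (hc' : c' ≠ 0) (hcc : c ≠ c') (hac : H a c = 0) (hbc : H b c = 0)
    (hac' : H a c' = 0) (hbc' : H b c' = 0) : H a b = 0 := by
  have key : ∀ c, c ≠ 0 → H a c = 0 → H b c = 0 → H a b = 0 ∨ F c = H a b := by
    intro c hc hac hbc
    have hFc : F c ≠ 0 := fun h => hc (hinj (h.trans hF.map_zero.symm))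
    have pol : ∀ x, H x c = 0 → B' (F x) (F c) = G x c := fun x hx => by
      have h1 := hG x c
      simp only [hF x c, hx, add_zero, hg (F x) (F c)] at h1
      exact add_left_cancel h1
    have h2 : B' (H a b) (F c) = 0 := by
      have h3 := pol (a + b) (by simp [hac, hbc])
      rw [hF a b, map_add, map_add, map_add, LinearMap.add_apply, LinearMap.add_apply,
        LinearMap.add_apply, pol a hac, pol b hbc] at h3
      simpa using h3
    rcases hB' _ _ h2 with h | h | h
    · exact Or.inl h
    · exact absurd h hFc
    · exact Or.inr h
  rcases key c hc hac hbc with h | h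
  · exact h
  rcases key c' hc' hac' hbc' with h' | h'
  · exact h'
  · exact absurd (hinj (h.trans h'.symm)) hcc

theorem card_eq_two_pow [Finite V] (p : Submodule (ZMod 2) V) :
    Nat.card p = 2 ^ finrank (ZMod 2) p := by
  rw [Module.natCard_eq_pow_finrank (K := ZMod 2), Nat.card_zmod]

theorem exists_two_ne_zero_of_finrank [Finite V] {p : Submodule (ZMod 2) V}
    (hp : 2 ≤ finrank (ZMod 2) p) : ∃ c ∈ p, ∃ c' ∈ p, c ≠ 0 ∧ c' ≠ 0 ∧ c ≠ c' := by
  classical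
  have := Fintype.ofFinite p
  have hcard : 2 < (Finset.univ : Finset p).card := by
    rw [Finset.card_univ, ← Nat.card_eq_fintype_card, card_eq_two_pow]
    exact lt_of_lt_of_le (by norm_num) (Nat.pow_le_pow_right (by norm_num) hp : 2 ^ 2 ≤ _)
  have h1 : 1 < (Finset.univ.erase (0 : p)).card := by
    rw [Finset.card_erase_of_mem (Finset.mem_univ _)]; omega
  obtain ⟨c, hc, c', hc', hne⟩ := Finset.one_lt_card.1 h1
  exact ⟨c, c.2, c', c'.2, by simpa using hc, by simpa using hc', fun h => hne (Subtype.ext h)⟩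

theorem IsAPNForm.finrank_ker_le [Finite V] (hB : IsAPNForm B) {a : V} (ha : a ≠ 0) :
    finrank (ZMod 2) (LinearMap.ker (B a)) ≤ 1 := by
  refine le_trans (Submodule.finrank_mono (?_ : _ ≤ Submodule.span (ZMod 2) {a}))
    (finrank_span_singleton ha).le
  intro b hb
  rcases hB a b hb with h | h | h
  · exact absurd h ha
  · rw [h]; exact zero_mem _
  · rw [h]; exact Submodule.mem_span_singleton_self a

theorem IsAPNForm.finrank_ker_comp_le [Finite V] (hB : IsAPNForm B) (C : V →ₗ[ZMod 2] V) {a : V}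
    (ha : a ≠ 0) : finrank (ZMod 2) (LinearMap.ker (B.compr₂ C a)) ≤
      finrank (ZMod 2) (LinearMap.ker C) + 1 := by
  let T : LinearMap.ker (B.compr₂ C a) →ₗ[ZMod 2] LinearMap.ker C :=
    (B a).restrict fun _ hb => hb
  have h1 := LinearMap.finrank_range_add_finrank_ker T
  have h2 := Submodule.finrank_le (LinearMap.range T)
  let T' : LinearMap.ker T →ₗ[ZMod 2] LinearMap.ker (B a) :=
    ((LinearMap.ker (B.compr₂ C a)).subtype ∘ₗ (LinearMap.ker T).subtype).codRestrict _
      fun x => congrArg Subtype.val x.2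
  have h3 := LinearMap.finrank_le_finrank_of_injective (f := T') fun x y hxy => by
    have : (T' x : V) = T' y := by rw [hxy]
    exact Subtype.ext (Subtype.ext this)
  have h4 := hB.finrank_ker_le ha
  omega

/-- For an APN form and `a ≠ 0`, at most one nonzero functional vanishes on the image of `B a`. -/
theorem IsAPNForm.functional_unique [Finite V] (hB : IsAPNForm B) {a : V} (ha : a ≠ 0)
    {ψ ψ' : V →ₗ[ZMod 2] ZMod 2} (hψ : ψ ≠ 0) (hψ' : ψ' ≠ 0) (h : ∀ b, ψ (B a b) = 0)
    (h' : ∀ b, ψ' (B a b) = 0) : ψ = ψ' := by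
  have hker := hB.finrank_ker_le ha
  have hr := LinearMap.finrank_range_add_finrank_ker (B a)
  have hlt : ∀ φ : V →ₗ[ZMod 2] ZMod 2, φ ≠ 0 → (∀ b, φ (B a b) = 0) →
      LinearMap.range (B a) = LinearMap.ker φ := by
    intro φ hφ hφa
    refine Submodule.eq_of_le_of_finrank_le ?_ ?_
    · rintro _ ⟨b, rfl⟩
      exact hφa b
    · have : finrank (ZMod 2) (LinearMap.ker φ) < finrank (ZMod 2) V :=
        Submodule.finrank_lt fun h => hφ (LinearMap.ker_eq_top.1 h)
      omega
  have hk : LinearMap.ker ψ = LinearMap.ker ψ' := (hlt ψ hψ h).symm.trans (hlt ψ' hψ' h')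
  ext x
  have hx : ψ x = 0 ↔ ψ' x = 0 := by
    rw [← LinearMap.mem_ker, ← LinearMap.mem_ker, hk]
  revert hx
  generalize ψ x = y; generalize ψ' x = z
  revert y z; decide

/-- For a linear map `C` of rank `m` and an APN form `B` on a space of dimension `2 * m`, suppose
that every functional `ψ = θ ∘ C ≠ 0` makes `ψ ∘ B` degenerate. As the radicals of these forms
meet trivially and have dimension at least two, they cannot all lie in a space of dimension
`m + 1`. -/
theorem three_mul_le_card [Finite V] {m : ℕ} (hV : finrank (ZMod 2) V = 2 * m)
    (hf : HasPolar f B) (hB : IsAPNForm B) {C : V →ₗ[ZMod 2] V}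
    (hrank : finrank (ZMod 2) (LinearMap.range C) = m)
    (hrad : ∀ θ : V →ₗ[ZMod 2] ZMod 2, θ ∘ₗ C ≠ 0 → ∃ a ≠ 0, ∀ b, θ (C (B a b)) = 0)
    {N : Submodule (ZMod 2) V}
    (hN : ∀ θ : V →ₗ[ZMod 2] ZMod 2, θ ∘ₗ C ≠ 0 → ∀ a, (∀ b, θ (C (B a b)) = 0) → a ∈ N) :
    3 * (2 ^ m - 1) ≤ 2 ^ finrank (ZMod 2) N - 1 := by
  classical
  have := Fintype.ofFinite V
  have : Finite (V →ₗ[ZMod 2] ZMod 2) := Module.finite_of_finite (ZMod 2)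
  have := Fintype.ofFinite (V →ₗ[ZMod 2] ZMod 2)
  let M : Submodule (ZMod 2) (V →ₗ[ZMod 2] ZMod 2) := LinearMap.range C.dualMap
  have hM : Nat.card M = 2 ^ m := by
    rw [card_eq_two_pow, LinearMap.finrank_range_dualMap_eq_finrank_range, hrank]
  let R : (V →ₗ[ZMod 2] ZMod 2) → Finset V := fun ψ =>
    Finset.univ.filter fun a => a ≠ 0 ∧ ∀ b, ψ (B a b) = 0
  let I : Finset (V →ₗ[ZMod 2] ZMod 2) := Finset.univ.filter fun ψ => ψ ∈ M ∧ ψ ≠ 0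
  have hI : I.card = 2 ^ m - 1 := by
    have h1 : I = ((M : Set (V →ₗ[ZMod 2] ZMod 2)).toFinset).erase 0 := by
      ext ψ; simp [I, and_comm]
    rw [h1, Finset.card_erase_of_mem (by simp), Set.toFinset_card, ← hM,
      ← Nat.card_eq_fintype_card]
    rfl
  have hR : ∀ ψ ∈ I, 3 ≤ (R ψ).card := by
    intro ψ hψ
    obtain ⟨-, ⟨θ, rfl⟩, hne⟩ := Finset.mem_filter.1 hψ
    obtain ⟨a, ha, hab⟩ := hrad θ hne
    have h4 := four_le_card_radical hV (hf.comp (θ ∘ₗ C)) ha (LinearMap.ext hab)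
    have h1 : R (C.dualMap θ) =
        ((LinearMap.ker (B.compr₂ (θ ∘ₗ C)) : Set V).toFinset).erase 0 := by
      ext x
      simp only [R, Finset.mem_filter, Finset.mem_univ, true_and, Finset.mem_erase,
        Set.mem_toFinset, SetLike.mem_coe, LinearMap.mem_ker, LinearMap.ext_iff]
      rfl
    rw [h1, Finset.card_erase_of_mem (by simp), Set.toFinset_card]
    rw [Nat.card_eq_fintype_card] at h4
    have : Fintype.card (LinearMap.ker (B.compr₂ (θ ∘ₗ C))) =
      Fintype.card ↑(LinearMap.ker (B.compr₂ (θ ∘ₗ C)) : Set V) := rfl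
    omega
  have hdisj : (I : Set (V →ₗ[ZMod 2] ZMod 2)).PairwiseDisjoint R := by
    intro ψ hψ ψ' hψ' hne
    rw [Function.onFun, Finset.disjoint_left]
    intro a ha ha'
    have h1 := (Finset.mem_filter.1 ha).2
    have h2 := (Finset.mem_filter.1 ha').2
    exact hne (hB.functional_unique h1.1 (Finset.mem_filter.1 hψ).2.2
      (Finset.mem_filter.1 hψ').2.2 h1.2 h2.2)
  have hsub : I.biUnion R ⊆ ((N : Set V).toFinset).erase 0 := by
    intro a ha
    obtain ⟨ψ, hψ, haψ⟩ := Finset.mem_biUnion.1 ha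
    obtain ⟨-, ⟨θ, rfl⟩, hne⟩ := Finset.mem_filter.1 hψ
    have h1 := (Finset.mem_filter.1 haψ).2
    simpa using ⟨h1.1, hN θ hne a h1.2⟩
  have hcardN : (((N : Set V).toFinset).erase 0).card = 2 ^ finrank (ZMod 2) N - 1 := by
    rw [Finset.card_erase_of_mem (by simp), Set.toFinset_card, ← card_eq_two_pow,
      Nat.card_eq_fintype_card]
    rfl
  calc 3 * (2 ^ m - 1) = ∑ ψ ∈ I, 3 := by rw [Finset.sum_const, hI, smul_eq_mul, mul_comm]
    _ ≤ ∑ ψ ∈ I, (R ψ).card := Finset.sum_le_sum hR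
    _ = (I.biUnion R).card := (Finset.card_biUnion hdisj).symm
    _ ≤ _ := Finset.card_le_card hsub
    _ = _ := hcardN

/-- CCZ-equivalence of quadratic APN maps `f` and `g` is induced by a linear equivalence of their
polar forms, provided that the components of `f` that vanish on some half-dimensional subspace `U`
are bent and that the values of the polar form span the space. -/
theorem exists_polar_equiv_of_ccz [Finite V] {m : ℕ} (hm : 2 ≤ m)
    (hV : finrank (ZMod 2) V = 2 * m) (hf : HasPolar f B) (hB : IsAPNForm B)
    (hg : HasPolar g B') (hB' : IsAPNForm B') {U : Submodule (ZMod 2) V}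
    (hU : finrank (ZMod 2) U = m)
    (hbent : ∀ ψ : V →ₗ[ZMod 2] ZMod 2, ψ ≠ 0 → (∀ u ∈ U, ψ u = 0) →
      ∀ a, (∀ b, ψ (B a b) = 0) → a = 0)
    (hspan : ∀ ψ : V →ₗ[ZMod 2] ZMod 2, (∀ a b, ψ (B a b) = 0) → ψ = 0)
    (h : CCZEquivalent f g) :
    ∃ A N : V →ₗ[ZMod 2] V, Function.Injective A ∧ ∀ a b, N (B a b) = B' (A a) (A b) := by
  have := Fintype.ofFinite V
  obtain ⟨L₁, L₂, hbij, hL⟩ := exists_linear_of_ccz hf.map_zero hg h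
  let F : V → V := fun x => L₁ (x, f x)
  let C : V →ₗ[ZMod 2] V := L₁ ∘ₗ LinearMap.inr _ _ _
  let E : V →ₗ[ZMod 2] V := L₂ ∘ₗ LinearMap.inr _ _ _
  let H := B.compr₂ C
  have hpol : ∀ L : V × V →ₗ[ZMod 2] V,
      HasPolar (fun x => L (x, f x)) (B.compr₂ (L ∘ₗ LinearMap.inr _ _ _)) := by
    intro L x y
    simp only [LinearMap.compr₂_apply, LinearMap.comp_apply, LinearMap.inr_apply, hf x y]
    rw [← map_add, ← map_add]
    simp
  have hF : HasPolar F H := hpol L₁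
  have hG : HasPolar (fun x => g (F x)) (B.compr₂ E) := by
    have : (fun x => g (F x)) = fun x => L₂ (x, f x) := funext hL
    rw [this]
    exact hpol L₂
  -- the components of `F` are balanced, so the forms `θ ∘ H` are degenerate
  have hrad : ∀ θ : V →ₗ[ZMod 2] ZMod 2, θ ∘ₗ C ≠ 0 → ∃ a ≠ 0, ∀ b, θ (C (B a b)) = 0 := by
    intro θ hθ
    have hθ0 : θ ≠ 0 := by
      rintro rfl
      exact hθ (LinearMap.zero_comp C)
    have h0 : ∑ x, signChar (θ (F x)) = 0 :=
      (Function.Bijective.sum_comp hbij fun x => signChar (θ x)).trans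
        (sum_signChar_eq_zero θ hθ0)
    obtain ⟨a, ha, hab⟩ := exists_radical_of_sum_eq_zero (hF.comp θ) h0
    exact ⟨a, ha, fun b => LinearMap.congr_fun hab b⟩
  -- bentness on `U` bounds the rank of `C` by `m`
  have hCrank := LinearMap.finrank_range_add_finrank_ker C
  have hker : m ≤ finrank (ZMod 2) (LinearMap.ker C) := by
    have htop : LinearMap.ker C ⊔ U = ⊤ := by
      by_contra hne
      obtain ⟨ψ, hψ, hmap⟩ := Submodule.exists_dual_map_eq_bot_of_lt_top (lt_top_iff_ne_top.2 hne)
        inferInstance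
      have hvan : ∀ x ∈ LinearMap.ker C ⊔ U, ψ x = 0 := fun x hx => by
        have : ψ x ∈ Submodule.map ψ (LinearMap.ker C ⊔ U) := ⟨x, hx, rfl⟩
        rwa [hmap] at this
      have hmem : ψ ∈ LinearMap.range C.dualMap := by
        rw [LinearMap.range_dualMap_eq_dualAnnihilator_ker, Submodule.mem_dualAnnihilator]
        exact fun x hx => hvan x (Submodule.mem_sup_left hx)
      obtain ⟨θ, rfl⟩ := hmem
      obtain ⟨a, ha, hab⟩ := hrad θ hψ
      exact ha (hbent _ hψ (fun u hu => hvan u (Submodule.mem_sup_right hu)) a hab)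
    have h1 := Submodule.finrank_add_le_finrank_add_finrank (LinearMap.ker C) U
    rw [htop, finrank_top] at h1
    omega
  have hHle : ∀ a, finrank (ZMod 2) (LinearMap.range (H a)) ≤
      finrank (ZMod 2) (LinearMap.range C) := fun a =>
    Submodule.finrank_mono (by rintro _ ⟨b, rfl⟩; exact ⟨B a b, rfl⟩)
  -- kernels with an intersection of dimension at least two
  have hHzero : ∀ a b, 2 * m + 2 ≤ finrank (ZMod 2) (LinearMap.ker (H a)) +
      finrank (ZMod 2) (LinearMap.ker (H b)) → H a b = 0 := by
    intro a b hab
    have h1 := Submodule.finrank_sup_add_finrank_inf_eq (LinearMap.ker (H a)) (LinearMap.ker (H b))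
    have h2 := Submodule.finrank_le (LinearMap.ker (H a) ⊔ LinearMap.ker (H b))
    obtain ⟨c, hc, c', hc', hc0, hc0', hcc⟩ := exists_two_ne_zero_of_finrank
      (p := LinearMap.ker (H a) ⊓ LinearMap.ker (H b)) (by omega)
    exact polar_eq_zero_of_common_kernel hF hbij.1 hg hB' hG hc0 hc0' hcc hc.1 hc.2 hc'.1 hc'.2
  have hC : C = 0 := by
    by_contra hC0
    rcases lt_or_eq_of_le hker with hlt | heq
    -- for rank less than `m`, all kernels are large and `H = 0`
    · have hH0 : ∀ a b, H a b = 0 := fun a b => hHzero a b (by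
        have h1 := LinearMap.finrank_range_add_finrank_ker (H a)
        have h2 := LinearMap.finrank_range_add_finrank_ker (H b)
        have h3 := hHle a
        have h4 := hHle b
        omega)
      refine hC0 (LinearMap.ext fun x => ?_)
      rw [LinearMap.zero_apply, ← Module.forall_dual_apply_eq_zero_iff (ZMod 2)]
      intro θ
      exact LinearMap.congr_fun (hspan (θ ∘ₗ C) fun a b => by
        have := hH0 a b
        simp only [H, LinearMap.compr₂_apply] at this
        simp [this]) x
    -- for rank `m`, the elements of the radicals have large kernels, so all lie in one of these
    · have hker2 : ∀ θ : V →ₗ[ZMod 2] ZMod 2, θ ∘ₗ C ≠ 0 → ∀ a, (∀ b, θ (C (B a b)) = 0) →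
          m + 1 ≤ finrank (ZMod 2) (LinearMap.ker (H a)) := by
        intro θ hθ a hab
        have h1 := LinearMap.finrank_range_add_finrank_ker (H a)
        have h2 : LinearMap.range (H a) < LinearMap.range C := by
          refine lt_of_le_of_ne (by rintro _ ⟨b, rfl⟩; exact ⟨B a b, rfl⟩) fun heq => hθ ?_
          ext x
          obtain ⟨b, hb⟩ : C x ∈ LinearMap.range (H a) := heq ▸ ⟨x, rfl⟩
          rw [LinearMap.comp_apply, ← hb]
          exact hab b
        have h3 := Submodule.finrank_lt_finrank_of_lt h2
        omega
      obtain ⟨θ₀, hθ₀⟩ : ∃ θ : V →ₗ[ZMod 2] ZMod 2, θ ∘ₗ C ≠ 0 := by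
        by_contra! hall
        refine hC0 (LinearMap.ext fun x => ?_)
        rw [LinearMap.zero_apply, ← Module.forall_dual_apply_eq_zero_iff (ZMod 2)]
        exact fun θ => LinearMap.congr_fun (hall θ) x
      obtain ⟨a₀, ha₀, hab₀⟩ := hrad θ₀ hθ₀
      have hka₀ := hker2 θ₀ hθ₀ a₀ hab₀
      have hcount := three_mul_le_card hV hf hB (C := C) (by omega) hrad
        (N := LinearMap.ker (H a₀)) (fun θ hθ a hab => hHzero a₀ a (by
          have := hker2 θ hθ a hab
          omega))
      have hka₀' : finrank (ZMod 2) (LinearMap.ker (H a₀)) ≤ m + 1 := by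
        have h1 := hB.finrank_ker_comp_le C ha₀
        rwa [← heq] at h1
      have h5 : 2 ^ finrank (ZMod 2) (LinearMap.ker (H a₀)) ≤ 2 ^ (m + 1) :=
        Nat.pow_le_pow_right (by norm_num) hka₀'
      have h6 : 2 ^ 2 ≤ 2 ^ m := Nat.pow_le_pow_right (by norm_num) hm
      rw [pow_succ] at h5
      omega
  have hL1 : ∀ x y, L₁ (x, y) = L₁ (x, 0) := fun x y => by
    have h1 : L₁ (x, y) = L₁ (x, 0) + C y := by
      simp only [C, LinearMap.comp_apply, LinearMap.inr_apply, ← map_add]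
      simp
    rw [h1, hC]; simp
  refine ⟨L₁ ∘ₗ LinearMap.inl _ _ _, E, fun x y hxy => hbij.1 ?_, fun a b => ?_⟩
  · simp only [hL1 _ (f _)]
    exact hxy
  · have h1 := hG a b
    have h2 : ∀ x, F x = L₁ (x, 0) := fun x => hL1 _ _
    simp only [h2, LinearMap.compr₂_apply] at h1
    have h3 : L₁ (a + b, 0) = L₁ (a, 0) + L₁ (b, 0) := by rw [← map_add]; simp
    rw [h3, hg] at h1
    exact (add_left_cancel h1).symm

end CCZ

/-! ### Linearized polynomials over `𝔽_{2^m}` -/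

section Linearized

open Module

variable {F : Type*} [Field F] [CharP F 2] {m : ℕ}

/-- The power of the Frobenius `x ↦ x ^ (2 ^ i)` of `𝔽_{2^m}`, with `i` taken modulo `m`. -/
def frob (F : Type*) [Field F] [CharP F 2] {m : ℕ} (i : ZMod m) : F →+* F :=
  iterateFrobenius F 2 i.val

theorem frob_natCast (hF : Nat.card F = 2 ^ m) (k : ℕ) (x : F) :
    frob F (k : ZMod m) x = x ^ 2 ^ k := by
  have hfin : Finite F := Nat.finite_of_card_ne_zero (by rw [hF]; positivity)
  have := Fintype.ofFinite F
  have hpow : ∀ y : F, ∀ j, y ^ (2 ^ m) ^ j = y := fun y j => by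
    rw [← hF, Nat.card_eq_fintype_card, FiniteField.pow_card_pow]
  rw [frob, iterateFrobenius_def, ZMod.val_natCast]
  conv_rhs => rw [← Nat.mod_add_div k m, pow_add, pow_mul, pow_mul 2, hpow]

theorem frob_zero (x : F) : frob F (0 : ZMod m) x = x := by
  simp [frob]

theorem frob_ne_zero (i : ZMod m) {x : F} (hx : x ≠ 0) : frob F i x ≠ 0 :=
  (map_ne_zero _).2 hx

variable [NeZero m]

theorem frob_add (hF : Nat.card F = 2 ^ m) (i j : ZMod m) (x : F) :
    frob F (i + j) x = frob F i (frob F j x) := by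
  have h : i + j = ((i.val + j.val : ℕ) : ZMod m) := by simp
  rw [h, frob_natCast hF, frob, frob, iterateFrobenius_def, iterateFrobenius_def, ← pow_mul,
    pow_add, mul_comm]

theorem frob_injective_index (hF : Nat.card F = 2 ^ m) :
    Function.Injective fun i : ZMod m => ((frob F i : F →+* F) : F →* F) := by
  intro i j hij
  have hfin : Finite F := Nat.finite_of_card_ne_zero (by rw [hF]; positivity)
  have := Fintype.ofFinite F
  obtain ⟨u, hu⟩ := IsCyclic.exists_generator (α := Fˣ)
  have hord : orderOf u = 2 ^ m - 1 := by
    rw [orderOf_eq_card_of_forall_mem_zpowers hu, Nat.card_units, hF]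
  have h1 : (u : F) ^ 2 ^ i.val = (u : F) ^ 2 ^ j.val := by
    have := DFunLike.congr_fun hij (u : F)
    simpa [frob, iterateFrobenius_def] using this
  have h2 : u ^ 2 ^ i.val = u ^ 2 ^ j.val := Units.ext (by push_cast; exact h1)
  rw [pow_eq_pow_iff_modEq, hord] at h2
  have hi := ZMod.val_lt i
  have hj := ZMod.val_lt j
  have hm1 : m = 1 ∨ 2 ≤ m := by have := NeZero.ne m; omega
  apply ZMod.val_injective m
  rcases hm1 with rfl | hm2
  · omega
  · have h4 : ∀ k < m, 2 ^ k < 2 ^ m - 1 := by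
      intro k hk
      have h3 : 2 ^ k ≤ 2 ^ (m - 1) := Nat.pow_le_pow_right (by norm_num) (by omega)
      have h5 : 2 ^ (m - 1) * 2 = 2 ^ m := by rw [← pow_succ]; congr 1; omega
      have h6 : 2 ^ 1 ≤ 2 ^ (m - 1) := Nat.pow_le_pow_right (by norm_num) (by omega)
      omega
    rw [Nat.ModEq, Nat.mod_eq_of_lt (h4 _ hi), Nat.mod_eq_of_lt (h4 _ hj)] at h2
    exact Nat.pow_right_injective le_rfl h2

/-- The linearized polynomial function `x ↦ ∑ i, a i * x ^ (2 ^ i)`. -/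
def linPoly (a : ZMod m → F) (x : F) : F := ∑ i, a i * frob F i x

/-- The function `(x, u) ↦ ∑ i j, M i j * x ^ (2 ^ i) * u ^ (2 ^ j)`. -/
def linPoly₂ (M : ZMod m → ZMod m → F) (x u : F) : F := ∑ i, ∑ j, M i j * frob F i x * frob F j u

theorem linPoly_eq_zero (hF : Nat.card F = 2 ^ m) {a : ZMod m → F} (h : ∀ x, linPoly a x = 0) :
    a = 0 := by
  have hli := (linearIndependent_monoidHom F F).comp _ (frob_injective_index (F := F) hF)
  rw [Fintype.linearIndependent_iff] at hli
  funext i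
  refine hli a ?_ i
  funext x
  simpa [linPoly] using h x

theorem linPoly_sub (a b : ZMod m → F) (x : F) :
    linPoly (fun i => a i - b i) x = linPoly a x - linPoly b x := by
  simp [linPoly, sub_mul]

theorem linPoly₂_congr (hF : Nat.card F = 2 ^ m) {M M' : ZMod m → ZMod m → F}
    (h : ∀ x u, linPoly₂ M x u = linPoly₂ M' x u) (i j : ZMod m) : M i j = M' i j := by
  have h1 : ∀ u, (fun i => linPoly (M i) u - linPoly (M' i) u) = 0 := fun u => by
    refine linPoly_eq_zero hF fun x => ?_
    have e : ∀ M : ZMod m → ZMod m → F, linPoly₂ M x u = linPoly (fun i => linPoly (M i) u) x := by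
      intro M
      simp only [linPoly₂, linPoly, Finset.sum_mul]
      exact Finset.sum_congr rfl fun i _ => Finset.sum_congr rfl fun j _ => by ring
    rw [linPoly_sub, ← e, ← e, h, sub_self]
  have h2 : (fun j => M i j - M' i j) = 0 := linPoly_eq_zero hF fun u => by
    rw [linPoly_sub]
    exact congrFun (h1 u) i
  exact sub_eq_zero.1 (congrFun h2 j)

/-- Every additive self-map of `𝔽_{2^m}` is given by a linearized polynomial. -/
theorem exists_linPoly [Algebra (ZMod 2) F] (hF : Nat.card F = 2 ^ m) (A : F →ₗ[ZMod 2] F) :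
    ∃ a : ZMod m → F, ∀ x, A x = linPoly a x := by
  have hfin : Finite F := Nat.finite_of_card_ne_zero (by rw [hF]; positivity)
  have := Fintype.ofFinite F
  have : Finite (F →ₗ[ZMod 2] F) := Module.finite_of_finite (ZMod 2)
  have := Fintype.ofFinite (F →ₗ[ZMod 2] F)
  let Φ : (ZMod m → F) → (F →ₗ[ZMod 2] F) := fun a =>
    AddMonoidHom.toZModLinearMap 2
      { toFun := linPoly a
        map_zero' := by simp [linPoly]
        map_add' := fun x y => by simp [linPoly, mul_add, Finset.sum_add_distrib] }
  have hΦ : ∀ a x, Φ a x = linPoly a x := fun _ _ => rfl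
  have hinj : Function.Injective Φ := fun a b hab => by
    have h : (fun i => a i - b i) = 0 := linPoly_eq_zero hF fun x => by
      rw [linPoly_sub, ← hΦ, ← hΦ, hab, sub_self]
    funext i
    exact sub_eq_zero.1 (congrFun h i)
  have hdim : finrank (ZMod 2) F = m := by
    have h1 := Module.natCard_eq_pow_finrank (K := ZMod 2) (V := F)
    rw [hF, Nat.card_zmod] at h1
    exact (Nat.pow_right_injective le_rfl h1).symm
  have hcard : Fintype.card (ZMod m → F) = Fintype.card (F →ₗ[ZMod 2] F) := by
    rw [← Nat.card_eq_fintype_card, ← Nat.card_eq_fintype_card,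
      Module.natCard_eq_pow_finrank (K := ZMod 2) (V := F →ₗ[ZMod 2] F), Module.finrank_linearMap,
      hdim, Nat.card_zmod, Nat.card_fun, hF, Nat.card_zmod, pow_mul]
  obtain ⟨a, ha⟩ := ((Fintype.bijective_iff_injective_and_card Φ).2 ⟨hinj, hcard⟩).2 A
  exact ⟨a, fun x => by rw [← ha, hΦ]⟩

/-- The coefficients of the composition of a linearized polynomial with `x ↦ x ^ (2 ^ l)`. -/
def shiftCoeff (l : ZMod m) (a : ZMod m → F) (i : ZMod m) : F := frob F l (a (i - l))

theorem frob_linPoly (hF : Nat.card F = 2 ^ m) (l : ZMod m) (a : ZMod m → F) (x : F) :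
    frob F l (linPoly a x) = linPoly (shiftCoeff l a) x := by
  simp only [linPoly, shiftCoeff, map_sum, map_mul]
  rw [← Equiv.sum_comp (Equiv.addRight l) fun i => frob F l (a (i - l)) * frob F i x]
  refine Finset.sum_congr rfl fun i _ => ?_
  simp only [Equiv.coe_addRight, add_comm i l, frob_add hF, add_sub_cancel_left]

theorem linPoly_mul_frob (hF : Nat.card F = 2 ^ m) (n : ZMod m → F) (s : ZMod m) (α z : F) :
    linPoly n (α * frob F s z) = linPoly (fun j => n (j - s) * frob F (j - s) α) z := by
  simp only [linPoly]
  refine Fintype.sum_equiv (Equiv.addRight s) _ _ fun i => ?_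
  simp only [Equiv.coe_addRight, add_sub_cancel_right, map_mul, frob_add hF]
  ring

theorem linPoly_mul_linPoly (a b : ZMod m → F) (x u : F) :
    linPoly a x * linPoly b u = linPoly₂ (fun i j => a i * b j) x u := by
  simp only [linPoly, linPoly₂, Finset.sum_mul_sum]
  exact Finset.sum_congr rfl fun i _ => Finset.sum_congr rfl fun j _ => by ring

theorem linPoly₂_add (M M' : ZMod m → ZMod m → F) (x u : F) :
    linPoly₂ M x u + linPoly₂ M' x u = linPoly₂ (fun i j => M i j + M' i j) x u := by
  simp only [linPoly₂, ← Finset.sum_add_distrib]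
  exact Finset.sum_congr rfl fun i _ => Finset.sum_congr rfl fun j _ => by ring

theorem mul_linPoly₂ (β : F) (M : ZMod m → ZMod m → F) (x u : F) :
    β * linPoly₂ M x u = linPoly₂ (fun i j => β * M i j) x u := by
  simp only [linPoly₂, Finset.mul_sum]
  exact Finset.sum_congr rfl fun i _ => Finset.sum_congr rfl fun j _ => by ring

theorem frob_linPoly₂ (hF : Nat.card F = 2 ^ m) (t : ZMod m) (M : ZMod m → ZMod m → F) (x u : F) :
    frob F t (linPoly₂ M x u) = linPoly₂ (fun i j => frob F t (M (i - t) (j - t))) x u := by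
  simp only [linPoly₂, map_sum, map_mul]
  refine Fintype.sum_equiv (Equiv.addRight t) _ _ fun i => ?_
  refine Fintype.sum_equiv (Equiv.addRight t) _ _ fun j => ?_
  simp only [Equiv.coe_addRight, add_comm _ t, frob_add hF, add_sub_cancel_left]

/-- The bilinear form `x ^ (2 ^ k) * u + x * u ^ (2 ^ k)` of the Gold function. -/
def goldForm (k : ZMod m) (x u : F) : F := frob F k x * u + x * frob F k u

theorem linPoly_mul (n : ZMod m → F) (x u : F) :
    linPoly n (x * u) = linPoly₂ (fun i j => if i = j then n j else 0) x u := by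
  simp only [linPoly, linPoly₂, map_mul, ite_mul, zero_mul]
  refine Finset.sum_congr rfl fun i _ => ?_
  rw [Finset.sum_ite_eq]
  simp [mul_assoc]

/-- The coefficients of `linPoly n ∘ goldForm k`. -/
def goldCoeff (k : ZMod m) (n : ZMod m → F) (i j : ZMod m) : F :=
  (if i = j + k then n j else 0) + if j = i + k then n i else 0

theorem linPoly_goldForm (hF : Nat.card F = 2 ^ m) (k : ZMod m) (n : ZMod m → F) (x u : F) :
    linPoly n (goldForm k x u) = linPoly₂ (goldCoeff k n) x u := by
  change _ = linPoly₂ (fun i j => _ + _) x u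
  rw [← linPoly₂_add]
  simp only [linPoly, linPoly₂, goldForm, map_mul, map_add, ite_mul, zero_mul, mul_add,
    Finset.sum_add_distrib]
  congr 1
  · rw [Finset.sum_comm]
    refine Finset.sum_congr rfl fun i _ => ?_
    rw [Finset.sum_ite_eq']
    simp [frob_add hF, mul_assoc]
  · refine Finset.sum_congr rfl fun i _ => ?_
    rw [Finset.sum_ite_eq']
    simp [frob_add hF, mul_assoc]

theorem goldForm_linPoly (hF : Nat.card F = 2 ^ m) (l : ZMod m) (a b : ZMod m → F) (x u : F) :
    goldForm l (linPoly a x) (linPoly b u) =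
      linPoly₂ (fun i j => frob F l (a (i - l)) * b j + a i * frob F l (b (j - l))) x u := by
  rw [goldForm, frob_linPoly hF, frob_linPoly hF, linPoly_mul_linPoly, linPoly_mul_linPoly,
    linPoly₂_add]
  rfl

end Linearized

/-! ### Coefficients of an equivalence -/

section Coefficients

variable {F : Type*} [Field F] [CharP F 2] {m : ℕ}

/-- The coefficient at `x ^ (2 ^ i) * u ^ (2 ^ j)` of
`goldForm l (a x) (b u) + β * (goldForm l (c x) (d u)) ^ (2 ^ t)`, for linearized polynomials
`a, b, c, d`. -/
def formCoeff (l t : ZMod m) (β : F) (a b c d : ZMod m → F) (i j : ZMod m) : F :=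
  frob F l (a (i - l)) * b j + a i * frob F l (b (j - l)) +
    β * frob F t (frob F l (c (i - t - l)) * d (j - t) + c (i - t) * frob F l (d (j - t - l)))

theorem goldForm_add_linPoly [NeZero m] (hF : Nat.card F = 2 ^ m) (l t : ZMod m) (β : F)
    (a b c d : ZMod m → F) (x u : F) :
    goldForm l (linPoly a x) (linPoly b u) +
      β * frob F t (goldForm l (linPoly c x) (linPoly d u)) =
        linPoly₂ (formCoeff l t β a b c d) x u := by
  rw [goldForm_linPoly hF, goldForm_linPoly hF, frob_linPoly₂ hF, mul_linPoly₂, linPoly₂_add]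
  rfl

theorem formCoeff_swap (l t : ZMod m) (β : F) (a b c d : ZMod m → F) (i j : ZMod m) :
    formCoeff l t β b a d c i j = formCoeff l t β a b c d j i := by
  simp only [formCoeff]
  rw [add_comm (frob F l (b (i - l)) * a j), add_comm (frob F l (d (i - t - l)) * c (j - t))]
  ring_nf

theorem add_eq_zero_iff_eq_two {x y : F} : x + y = 0 ↔ x = y := CharTwo.add_eq_zero

/-- The relation `x * y' + y * x' = 0`, that is proportionality, is transitive through nonzero
vectors. -/
theorem det_eq_zero_trans {a c b d a' c' : F} (h : a * d + c * b = 0) (h' : a' * d + c' * b = 0)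
    (hne : b ≠ 0 ∨ d ≠ 0) : a * c' + c * a' = 0 := by
  rw [add_eq_zero_iff_eq_two] at *
  rcases hne with hb | hd
  · apply mul_right_cancel₀ hb
    linear_combination a' * h - a * h'
  · apply mul_right_cancel₀ hd
    linear_combination c' * h - c * h'

/-- Two independent vectors have no common nonzero multiple. -/
theorem eq_zero_of_det {a c b d x y : F} (hdet : a * d + c * b ≠ 0) (h1 : x * d + y * b = 0)
    (h2 : a * y + c * x = 0) : x = 0 ∧ y = 0 := by
  have two : (2 : F) = 0 := CharTwo.two_eq_zero
  constructor
  · apply mul_right_cancel₀ hdet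
    linear_combination a * h1 + b * h2 - a * b * y * two
  · apply mul_right_cancel₀ hdet
    linear_combination d * h2 + c * h1 - c * d * x * two

/-- Some pair of coefficient vectors with the same index is independent: otherwise all coefficient
vectors lie on one line. -/
theorem exists_det_ne_zero {a b c d : ZMod m → F} (hA : ∃ i, a i ≠ 0 ∨ c i ≠ 0)
    (hD : ∃ i, b i ≠ 0 ∨ d i ≠ 0) (hdet : ∀ i j, i ≠ j → a i * d j + c i * b j = 0)
    (hspan : ∀ p q, (∀ i, p * a i + q * c i = 0) → (∀ i, p * b i + q * d i = 0) →
      p = 0 ∧ q = 0) : ∃ i, a i * d i + c i * b i ≠ 0 := by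
  by_contra! hall
  have hdet' : ∀ i j, a i * d j + c i * b j = 0 := fun i j => by
    by_cases hij : i = j
    · rw [hij]; exact hall j
    · exact hdet i j hij
  obtain ⟨i, hi⟩ := hA
  obtain ⟨j, hj⟩ := hD
  have h1 := hspan (c i) (a i)
    (fun i' => by
      rw [add_comm]
      exact det_eq_zero_trans (hdet' i j) (hdet' i' j) hj)
    (fun j' => by
      rw [add_comm]
      exact hdet' i j')
  rcases hi with hi | hi
  · exact hi h1.2
  · exact hi h1.1

theorem exists_smul_of_det {b d x y : F} (hbd : b ≠ 0 ∨ d ≠ 0) (hxy : x * d + y * b = 0) :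
    ∃ r, x = r * b ∧ y = r * d := by
  rw [add_eq_zero_iff_eq_two] at hxy
  rcases hbd with hb | hd
  · exact ⟨x / b, by field_simp, by field_simp; exact hxy.symm⟩
  · exact ⟨y / d, by field_simp; exact hxy, by field_simp⟩

/-- As `b * b ^ (2 ^ l)` and `d * d ^ (2 ^ l)` are cubes, `b * b ^ (2 ^ l) = β * d * d ^ (2 ^ l)`
is impossible for a non-cube `β`. -/
theorem eq_zero_of_norm_add {l : ZMod m} {β : F} (hl : ∀ z : F, ∃ y, z * frob F l z = y ^ 3)
    (hβ : ∀ y, y ^ 3 ≠ β) {b d : F} (h : b * frob F l b + β * (d * frob F l d) = 0) :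
    b = 0 ∧ d = 0 := by
  have hd : d = 0 := by
    by_contra hd
    obtain ⟨y, hy⟩ := hl b
    obtain ⟨z, hz⟩ := hl d
    have hz0 : z ≠ 0 := by
      rintro rfl
      simp [hd] at hz
    rw [add_eq_zero_iff_eq_two, hy, hz] at h
    exact hβ (y / z) (by field_simp; linear_combination h)
  subst hd
  simpa using h

/-- If the coefficients of `a, c` and `b, d` are supported on `{0, k, -k}`, then the absence of
off-diagonal terms in `formCoeff` forces the coefficients of `a, c` at `k` to vanish. The parity
map `π` excludes most of the possible cancellations. -/
theorem coeff_eq_zero {π : ZMod m →+* ZMod 2} {k l t : ZMod m} {β : F}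
    (hk1 : π k = 1) (hl1 : π l = 1) (ht0 : π t = 0) (hll : l + l ≠ 0)
    (hl : ∀ z : F, ∃ y, z * frob F l z = y ^ 3) (hβ : ∀ y, y ^ 3 ≠ β)
    (hkl : (k ≠ l ∧ ¬ (t = k - l ∧ t + t = 0)) ∨ (k + l ≠ 0 ∧ ¬ (t = k + l ∧ t + t = 0)))
    {a b c d : ZMod m → F}
    (hA0 : ∀ j, π j = 0 → j ≠ 0 → a j = 0 ∧ c j = 0)
    (hD0 : ∀ j, π j = 0 → j ≠ 0 → b j = 0 ∧ d j = 0)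
    (hD1 : ∀ j, π j = 1 → j ≠ k → j ≠ -k → b j = 0 ∧ d j = 0)
    (hdet : a 0 * d 0 + c 0 * b 0 ≠ 0) (hpar : a k * d 0 + c k * b 0 = 0)
    (hM : ∀ i j, i ≠ j → formCoeff l t β a b c d i j = 0) : a k = 0 ∧ c k = 0 := by
  have hβ0 : β ≠ 0 := fun h => hβ 0 (by rw [h]; ring)
  have hbd : b 0 ≠ 0 ∨ d 0 ≠ 0 := by
    by_contra! h
    exact hdet (by rw [h.1, h.2]; ring)
  obtain ⟨r, hr1, hr2⟩ := exists_smul_of_det hbd hpar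
  by_contra hne0
  have hr : r ≠ 0 := by
    rintro rfl
    exact hne0 (by simp [hr1, hr2])
  suffices b 0 = 0 ∧ d 0 = 0 by tauto
  rcases hkl with ⟨hne, hnt⟩ | ⟨hne, hnt⟩
  · -- the terms at `(k, l)` and `(k + t, l + t)`
    have hkl := hA0 (k - l) (by simp [hk1, hl1]) (sub_ne_zero.2 hne)
    have h3 : frob F l (c (k - t - l)) * d (l - t) = 0 := by
      by_cases hc : k - t - l = 0
      · have htt : t = k - l := by linear_combination -hc
        rw [(hD1 (l - t) (by simp [hl1, ht0]) (fun h => hnt ⟨htt, by linear_combination htt - h⟩)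
          (fun h => hll (by linear_combination h + htt))).2, mul_zero]
      · rw [(hA0 _ (by simp [hk1, hl1, ht0]) hc).2, map_zero, zero_mul]
    have hM1 := hM k l hne
    simp only [formCoeff, hkl.1, h3, map_zero, zero_mul, zero_add, sub_self, sub_right_comm l t l,
      zero_sub] at hM1
    by_cases ht : t = 0
    · subst ht
      simp only [frob_zero, sub_zero, neg_zero, hr1, hr2] at hM1
      refine eq_zero_of_norm_add hl hβ (mul_left_cancel₀ hr ?_)
      linear_combination hM1
    · have h1 : frob F l (a (k + t - l)) * b (l + t) = 0 := by
        by_cases ha : k + t - l = 0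
        · have htt : t = l - k := by linear_combination ha
          rw [(hD1 (l + t) (by simp [hl1, ht0])
            (fun h => hnt ⟨by linear_combination h, by linear_combination htt + h⟩)
            (fun h => hll (by linear_combination h - htt))).1, mul_zero]
        · rw [(hA0 _ (by simp [hk1, hl1, ht0]) ha).1, map_zero, zero_mul]
      have hM2 := hM (k + t) (l + t) (fun h => hne (add_right_cancel h))
      simp only [formCoeff, h1, add_sub_cancel_right, hkl.2, map_zero, zero_mul, zero_add,
        add_sub_cancel_left, sub_self, (hD0 t ht0 ht).1, mul_zero, hr2] at hM2
      rw [(hD0 (-t) (by simp [ht0]) (neg_ne_zero.2 ht)).2, hr1] at hM1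
      constructor
      · simpa [hr] using hM1
      · simpa [hr, hβ0] using hM2
  · -- the terms at `(k + l, 0)` and `(k + l + t, t)`
    have hkl := hA0 (k + l) (by simp [hk1, hl1]; decide) hne
    have h4 : c (k + l - t) * frob F l (d (0 - t - l)) = 0 := by
      by_cases hc : k + l - t = 0
      · have htt : t = k + l := by linear_combination -hc
        rw [(hD1 (0 - t - l) (by simp [hl1, ht0])
          (fun h => hnt ⟨htt, by linear_combination htt - h⟩)
          (fun h => hll (by linear_combination -h - htt))).2, map_zero, mul_zero]
      · rw [(hA0 _ (by simp [hk1, hl1, ht0]; decide) hc).2, zero_mul]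
    have hM1 := hM (k + l) 0 hne
    simp only [formCoeff, add_sub_cancel_right, hkl.1, h4, zero_mul, add_zero,
      sub_right_comm (k + l) t l] at hM1
    by_cases ht : t = 0
    · subst ht
      simp only [frob_zero, sub_zero, hr1, hr2, map_mul] at hM1
      refine eq_zero_of_norm_add hl hβ (mul_left_cancel₀ (frob_ne_zero l hr) ?_)
      linear_combination hM1
    · have h1 : a (k + l + t) * frob F l (b (t - l)) = 0 := by
        by_cases ha : k + l + t = 0
        · have htt : t = -(k + l) := by linear_combination ha
          rw [(hD1 (t - l) (by simp [hl1, ht0])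
            (fun h => hnt ⟨by linear_combination h, by linear_combination htt + h⟩)
            (fun h => hll (by linear_combination htt - h))).1, map_zero, mul_zero]
        · rw [(hA0 _ (by simp [hk1, hl1, ht0]; decide) ha).1, zero_mul]
      have hM2 := hM (k + l + t) t (fun h => hne (by linear_combination h))
      simp only [formCoeff, h1, add_sub_cancel_right, hkl.2, zero_mul, add_zero, zero_add,
        sub_self, (hD0 t ht0 ht).1, mul_zero, hr2, map_mul] at hM2
      rw [(hD0 (0 - t) (by simp [ht0]) (by simpa using ht)).2, hr1] at hM1
      constructor
      · simpa [hr] using hM1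
      · simpa [hr, hβ0] using hM2

/-- The case in which a single power of the Frobenius occurs in the equivalence. The mixed terms
then make it diagonal or anti-diagonal, and the remaining terms determine the exponents. -/
theorem index_eq_of_monomial {π : ZMod m →+* ZMod 2} {k l s t : ZMod m} {β : F}
    (hk1 : π k = 1) (hl1 : π l = 1) (hs0 : π s = 0) (ht0 : π t = 0) (hkk : k + k ≠ 0)
    (hkl : k + l ≠ 0) (hl : ∀ z : F, ∃ y, z * frob F l z = y ^ 3) (hβ : ∀ y, y ^ 3 ≠ β)
    {a b c d n n' : ZMod m → F} (hA : ∀ j, j ≠ 0 → a j = 0 ∧ c j = 0)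
    (hD : ∀ j, j ≠ 0 → b j = 0 ∧ d j = 0) (hdet : a 0 * d 0 + c 0 * b 0 ≠ 0)
    (hM : ∀ i j, i ≠ j → formCoeff l t β a b c d i j = 0)
    (hMA : ∀ i j, formCoeff l t β a a c c i j = goldCoeff k n i j)
    (hMD : ∀ i j, formCoeff l t β b b d d i j = goldCoeff k n' i j)
    (hn : ∀ j, n (j - s) ≠ 0 → n' j ≠ 0) : k = l ∧ (s = t ∨ s + t = 0) := by
  have hβ0 : β ≠ 0 := fun h => hβ 0 (by rw [h]; ring)
  have hodd : ∀ j, π j = 1 → j ≠ 0 := by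
    rintro j hj rfl
    simp at hj
  have hl0 := hodd l hl1
  have hlt := hodd (l - t) (by simp [hl1, ht0])
  have hab : a 0 * b 0 = 0 ∧ c 0 * d 0 = 0 := by
    have e1 := hM l 0 hl0
    have e2 := hM 0 l hl0.symm
    simp only [formCoeff, sub_self, (hA l hl0).1, (hD l hl0).1, zero_mul, mul_zero, add_zero,
      zero_add, sub_right_comm l t l, (hA _ hlt).2, (hD _ hlt).2, zero_sub, map_mul] at e1 e2
    by_cases ht : t = 0
    · subst ht
      simp only [neg_zero, frob_zero] at e1 e2
      by_cases h0 : a 0 * b 0 = 0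
      · refine ⟨h0, ?_⟩
        rcases mul_eq_zero.1 h0 with h | h <;> simpa [h, hβ0] using e1
      · -- multiplying the two equations exhibits `β ^ 2` as a cube
        exfalso
        rw [add_eq_zero_iff_eq_two] at e1 e2
        have hcd : c 0 * d 0 ≠ 0 := by
          intro h
          rcases mul_eq_zero.1 h with h | h <;> simp [h] at e1 <;> exact h0 (mul_eq_zero.2 e1)
        obtain ⟨y, hy⟩ := hl (a 0 * b 0)
        obtain ⟨z, hz⟩ := hl (c 0 * d 0)
        have hyz : y ^ 3 = β ^ 2 * z ^ 3 := by
          rw [← hy, ← hz, map_mul, map_mul]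
          linear_combination e1 * (a 0 * frob F l (b 0)) +
            β * (frob F l (c 0) * d 0) * e2
        have hz0 : z ≠ 0 := by
          rintro rfl
          refine mul_ne_zero hcd (frob_ne_zero l hcd) (hz.trans (by ring))
        have hy0 : y ≠ 0 := by
          rintro rfl
          have : β ^ 2 * z ^ 3 ≠ 0 := by positivity
          exact this (by rw [← hyz]; ring)
        refine hβ (β * z / y) ?_
        field_simp
        linear_combination (-1 : F) * hyz
    · have e3 := hM (l + t) t (fun h => hl0 (by linear_combination h))
      have hlt' := hodd (l + t) (by simp [hl1, ht0])
      simp only [formCoeff, add_sub_cancel_right, add_sub_cancel_left, (hA t ht).1,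
        (hA _ hlt').1, sub_self,
        (hA l hl0).2, map_zero, zero_mul, zero_add, add_zero] at e3
      rw [(hA (-t) (neg_ne_zero.2 ht)).2] at e1
      constructor
      · rw [mul_eq_zero]
        simpa using e1
      · rw [mul_eq_zero]
        simpa [hβ0] using e3
  -- the map is anti-diagonal (then `s = -t`) or diagonal (then `s = t`)
  rcases mul_eq_zero.1 hab.1 with ha0 | hb0
  · have hd0 : d 0 = 0 := (mul_eq_zero.1 hab.2).resolve_left fun h => hdet (by rw [ha0, h]; ring)
    have hcb : c 0 * b 0 ≠ 0 := by simpa [ha0] using hdet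
    have ha : ∀ j, a j = 0 := fun j => by
      by_cases hj : j = 0
      · rw [hj, ha0]
      · exact (hA j hj).1
    have hd : ∀ j, d j = 0 := fun j => by
      by_cases hj : j = 0
      · rw [hj, hd0]
      · exact (hD j hj).2
    have e1 := hMA (l + t) t
    have hne : formCoeff l t β a a c c (l + t) t ≠ 0 := by
      simp [formCoeff, ha, hβ0, (hA l hl0).2, left_ne_zero_of_mul hcb]
    have h2 : t ≠ l + t + k := fun h => hkl (by linear_combination -h)
    rw [e1, goldCoeff, if_neg h2, add_zero] at hne
    obtain ⟨h3, h4⟩ := ite_ne_right_iff.1 hne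
    have hkl' : k = l := by linear_combination -h3
    subst hkl'
    refine ⟨rfl, Or.inr ?_⟩
    have e2 := hMD (t + s + k) (t + s)
    have h5 : t + s ≠ t + s + k + k := fun h => hkk (by linear_combination -h)
    rw [goldCoeff, if_pos rfl, if_neg h5, add_zero] at e2
    have h6 := hn (t + s) (by rwa [add_sub_cancel_right])
    rw [← e2] at h6
    by_contra hst
    have hts : t + s ≠ 0 := by rwa [add_comm]
    have htsk := hodd (t + s + k) (by simp [hs0, hk1, ht0])
    exact h6 (by simp [formCoeff, hd, (hD _ hts).1, (hD _ htsk).1])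
  · have hc0 : c 0 = 0 := (mul_eq_zero.1 hab.2).resolve_right fun h => hdet (by rw [hb0, h]; ring)
    have had : a 0 * d 0 ≠ 0 := by simpa [hc0] using hdet
    have hc : ∀ j, c j = 0 := fun j => by
      by_cases hj : j = 0
      · rw [hj, hc0]
      · exact (hA j hj).2
    have hb : ∀ j, b j = 0 := fun j => by
      by_cases hj : j = 0
      · rw [hj, hb0]
      · exact (hD j hj).1
    have e1 := hMA l 0
    have hne : formCoeff l t β a a c c l 0 ≠ 0 := by
      simp [formCoeff, hc, (hA l hl0).1, left_ne_zero_of_mul had]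
    have h2 : (0 : ZMod m) ≠ l + k := fun h => hkl (by linear_combination -h)
    rw [e1, goldCoeff, if_neg h2, add_zero] at hne
    obtain ⟨h3, h4⟩ := ite_ne_right_iff.1 hne
    have hkl' : k = l := by linear_combination -h3
    subst hkl'
    refine ⟨rfl, Or.inl ?_⟩
    have e2 := hMD (s + k) s
    have h5 : s ≠ s + k + k := fun h => hkk (by linear_combination -h)
    rw [goldCoeff, if_pos rfl, if_neg h5, add_zero] at e2
    have h6 := hn s (by rwa [sub_self])
    rw [← e2] at h6
    by_contra hst
    have hskt := hodd (s + k - t) (by simp [hs0, hk1, ht0])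
    exact h6 (by simp [formCoeff, hb, (hD _ hskt).2, (hD _ (sub_ne_zero.2 hst)).2])

/-- The coefficient form of the inequivalence: the vectors `(a i, c i)` and `(b i, d i)` are the
coefficients of a bijective linear map of the plane that carries the polar form of `f_{k,s,α}` to
that of `f_{l,t,β}`. -/
theorem index_eq_of_coeff {π : ZMod m →+* ZMod 2} {k l s t : ZMod m} {β : F}
    (hk1 : π k = 1) (hl1 : π l = 1) (hs0 : π s = 0) (ht0 : π t = 0) (hkk : k + k ≠ 0)
    (hll : l + l ≠ 0) (hkl : k + l ≠ 0) (hkl2 : k ≠ l → k + k ≠ l + l)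
    (hklt : k = l → t + t = 0 → t = 0)
    (hl : ∀ z : F, ∃ y, z * frob F l z = y ^ 3) (hβ : ∀ y, y ^ 3 ≠ β)
    {a b c d n n' : ZMod m → F} (hA : ∃ i, a i ≠ 0 ∨ c i ≠ 0) (hD : ∃ i, b i ≠ 0 ∨ d i ≠ 0)
    (hspan : ∀ p q, (∀ i, p * a i + q * c i = 0) → (∀ i, p * b i + q * d i = 0) →
      p = 0 ∧ q = 0)
    (hAD : ∀ i j, i ≠ j → a i * d j + c i * b j = 0)
    (hAA : ∀ i j, i ≠ j + k → j ≠ i + k → a i * c j + c i * a j = 0)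
    (hDD : ∀ i j, i ≠ j + k → j ≠ i + k → b i * d j + d i * b j = 0)
    (hM : ∀ i j, i ≠ j → formCoeff l t β a b c d i j = 0)
    (hMA : ∀ i j, formCoeff l t β a a c c i j = goldCoeff k n i j)
    (hMD : ∀ i j, formCoeff l t β b b d d i j = goldCoeff k n' i j)
    (hn : ∀ j, n (j - s) ≠ 0 → n' j ≠ 0) : k = l ∧ (s = t ∨ s + t = 0) := by
  obtain ⟨o, ho⟩ := exists_det_ne_zero hA hD hAD hspan
  have hk0 : k ≠ 0 := by rintro rfl; simp at hkk
  -- the indices are taken relative to `o`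
  have hshift : ∀ a b c d : ZMod m → F, ∀ i j,
      formCoeff l t β (fun i => a (o + i)) (fun i => b (o + i)) (fun i => c (o + i))
        (fun i => d (o + i)) i j = formCoeff l t β a b c d (o + i) (o + j) := by
    intro a b c d i j
    simp only [formCoeff, add_sub_assoc]
  have hAne : ∀ j, j ≠ 0 → a (o + j) * d o + c (o + j) * b o = 0 := fun j hj =>
    hAD _ _ (by simpa using hj)
  have hDne : ∀ j, j ≠ 0 → b (o + j) * c o + d (o + j) * a o = 0 := fun j hj => by
    have := hAD o (o + j) (by simpa using hj)
    linear_combination this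
  have hAsupp : ∀ j, j ≠ 0 → j ≠ k → j ≠ -k → a (o + j) = 0 ∧ c (o + j) = 0 := by
    intro j h0 h1 h2
    refine eq_zero_of_det ho (hAne j h0) (hAA _ _ (fun h => h2 ?_) (fun h => h1 ?_))
    · linear_combination -h
    · linear_combination h
  have hDsupp : ∀ j, j ≠ 0 → j ≠ k → j ≠ -k → b (o + j) = 0 ∧ d (o + j) = 0 := by
    intro j h0 h1 h2
    refine eq_zero_of_det (a := b o) (c := d o) (b := a o) (d := c o)
      (fun h => ho (by linear_combination h)) (hDne j h0)
      (hDD _ _ (fun h => h2 ?_) (fun h => h1 ?_))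
    · linear_combination -h
    · linear_combination h
  have heven : ∀ j, π j = 0 → j ≠ k ∧ j ≠ -k := by
    intro j hj
    constructor <;> rintro rfl <;> simp [hk1] at hj
  have hodd : ∀ j, π j = 1 → j ≠ 0 := by
    rintro j hj rfl
    simp at hj
  have hplus : (k ≠ l ∧ ¬ (t = k - l ∧ t + t = 0)) ∨ (k + l ≠ 0 ∧ ¬ (t = k + l ∧ t + t = 0)) := by
    by_cases h : k = l
    · right
      refine ⟨hkl, fun h' => hkl ?_⟩
      rw [← h'.1, hklt h h'.2]
    · left
      refine ⟨h, fun h' => hkl2 h ?_⟩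
      linear_combination h'.2 - 2 * h'.1
  have hminus : (-k ≠ l ∧ ¬ (t = -k - l ∧ t + t = 0)) ∨
      (-k + l ≠ 0 ∧ ¬ (t = -k + l ∧ t + t = 0)) := by
    by_cases h : k = l
    · left
      refine ⟨fun h' => hkl (by linear_combination -h'), fun h' => hkl ?_⟩
      linear_combination h'.1 - hklt h h'.2
    · right
      refine ⟨fun h' => h (by linear_combination -h'), fun h' => hkl2 h ?_⟩
      linear_combination 2 * h'.1 - h'.2
  have hnk1 : π (-k) = 1 := by rw [map_neg, hk1]; decide
  have hA0 : ∀ j, π j = 0 → j ≠ 0 → a (o + j) = 0 ∧ c (o + j) = 0 := fun j hj h0 =>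
    hAsupp j h0 (heven j hj).1 (heven j hj).2
  have hD0 : ∀ j, π j = 0 → j ≠ 0 → b (o + j) = 0 ∧ d (o + j) = 0 := fun j hj h0 =>
    hDsupp j h0 (heven j hj).1 (heven j hj).2
  have hA1 : ∀ j, π j = 1 → j ≠ k → j ≠ -k → a (o + j) = 0 ∧ c (o + j) = 0 := fun j hj =>
    hAsupp j (hodd j hj)
  have hD1 : ∀ j, π j = 1 → j ≠ k → j ≠ -k → b (o + j) = 0 ∧ d (o + j) = 0 := fun j hj =>
    hDsupp j (hodd j hj)
  have hM' : ∀ i j, i ≠ j → formCoeff l t β (fun i => a (o + i)) (fun i => b (o + i))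
      (fun i => c (o + i)) (fun i => d (o + i)) i j = 0 := fun i j hij => by
    rw [hshift]
    exact hM _ _ (by simpa using hij)
  have hM'' : ∀ i j, i ≠ j → formCoeff l t β (fun i => b (o + i)) (fun i => a (o + i))
      (fun i => d (o + i)) (fun i => c (o + i)) i j = 0 := fun i j hij => by
    rw [formCoeff_swap]
    exact hM' _ _ hij.symm
  have hdet : a (o + 0) * d (o + 0) + c (o + 0) * b (o + 0) ≠ 0 := by simpa using ho
  have hdet' : b (o + 0) * c (o + 0) + d (o + 0) * a (o + 0) ≠ 0 := fun h =>
    hdet (by linear_combination h)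
  have hneg : ∀ {P : ZMod m → Prop}, (∀ j, π j = 1 → j ≠ k → j ≠ -k → P j) →
      ∀ j, π j = 1 → j ≠ -k → j ≠ - -k → P j := fun h j hj h1 h2 =>
    h j hj (by simpa using h2) h1
  -- the remaining coefficients vanish, by symmetry in `k ↦ -k` and in the two coordinates
  have hAk := coeff_eq_zero hk1 hl1 ht0 hll hl hβ hplus hA0 hD0 hD1 hdet
    (by simpa using hAne k hk0) hM'
  have hAnk := coeff_eq_zero hnk1 hl1 ht0 hll hl hβ hminus hA0 hD0 (hneg hD1) hdet
    (by simpa using hAne (-k) (neg_ne_zero.2 hk0)) hM'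
  have hDk := coeff_eq_zero hk1 hl1 ht0 hll hl hβ hplus hD0 hA0 hA1 hdet'
    (by simpa using hDne k hk0) hM''
  have hDnk := coeff_eq_zero hnk1 hl1 ht0 hll hl hβ hminus hD0 hA0 (hneg hA1) hdet'
    (by simpa using hDne (-k) (neg_ne_zero.2 hk0)) hM''
  refine index_eq_of_monomial (a := fun i => a (o + i)) (b := fun i => b (o + i))
    (c := fun i => c (o + i)) (d := fun i => d (o + i)) (n := fun i => n (o + i))
    (n' := fun i => n' (o + i)) hk1 hl1 hs0 ht0 hkk hkl hl hβ (fun j hj => ?_) (fun j hj => ?_)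
    hdet hM' (fun i j => ?_) (fun i j => ?_) (fun j hj => ?_)
  · by_cases h1 : j = k
    · rw [h1]; exact hAk
    by_cases h2 : j = -k
    · rw [h2]; exact hAnk
    exact hAsupp j hj h1 h2
  · by_cases h1 : j = k
    · rw [h1]; exact hDk
    by_cases h2 : j = -k
    · rw [h2]; exact hDnk
    exact hDsupp j hj h1 h2
  · rw [hshift, hMA]
    simp only [goldCoeff, add_assoc, add_right_inj]
  · rw [hshift, hMD]
    simp only [goldCoeff, add_assoc, add_right_inj]
  · exact hn _ (by rwa [add_sub_assoc])

end Coefficients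

/-! ### The polar form of a Pott–Zhou function -/

section PottZhou

open Module

variable {F : Type*} [Field F] [CharP F 2] {m : ℕ}

theorem goldForm_add_right (k : ZMod m) (x u v : F) :
    goldForm k x (u + v) = goldForm k x u + goldForm k x v := by
  simp only [goldForm, map_add]; ring

theorem goldForm_add_left (k : ZMod m) (x y u : F) :
    goldForm k (x + y) u = goldForm k x u + goldForm k y u := by
  simp only [goldForm, map_add]; ring

theorem goldForm_zero_right (k : ZMod m) (x : F) : goldForm k x 0 = 0 := by simp [goldForm]

theorem goldForm_zero_left (k : ZMod m) (x : F) : goldForm k 0 x = 0 := by simp [goldForm]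

variable [Algebra (ZMod 2) F]

/-- The polar form of the Pott–Zhou function `f_{k,s,α}`, with exponents taken modulo `m`. -/
def pzForm (k s : ZMod m) (α : F) : F × F →ₗ[ZMod 2] F × F →ₗ[ZMod 2] F × F :=
  AddMonoidHom.toZModLinearMap 2 <| AddMonoidHom.mk'
    (fun p => AddMonoidHom.toZModLinearMap 2 <| AddMonoidHom.mk'
      (fun q => (goldForm k p.1 q.1 + α * frob F s (goldForm k p.2 q.2), p.1 * q.2 + p.2 * q.1))
      fun q q' => by
        ext
        · simp only [Prod.fst_add, Prod.snd_add, goldForm_add_right, map_add]; ring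
        · simp only [Prod.fst_add, Prod.snd_add]; ring)
    fun p p' => by
      refine LinearMap.ext fun q => ?_
      change ((_, _) : F × F) = (_, _) + (_, _)
      ext
      · simp only [Prod.fst_add, Prod.snd_add, goldForm_add_left, map_add]; ring
      · simp only [Prod.fst_add, Prod.snd_add]; ring

theorem pzForm_apply (k s : ZMod m) (α : F) (p q : F × F) : pzForm k s α p q =
    (goldForm k p.1 q.1 + α * frob F s (goldForm k p.2 q.2), p.1 * q.2 + p.2 * q.1) := rfl

theorem hasPolar_pottZhou (hF : Nat.card F = 2 ^ m) (k s : ℕ) (α : F) :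
    HasPolar (pottZhou k s α) (pzForm (k : ZMod m) (s : ZMod m) α) := by
  intro p q
  have h : ∀ z : F, z ^ (2 ^ k + 1) = frob F (k : ZMod m) z * z := fun z => by
    rw [frob_natCast hF, pow_succ]
  have h' : ∀ z : F, z ^ ((2 ^ k + 1) * 2 ^ s) =
      frob F (s : ZMod m) (frob F (k : ZMod m) z * z) := fun z => by
    rw [frob_natCast hF, ← h, pow_mul]
  simp only [pottZhou, pzForm_apply, h, h', goldForm]
  ext
  · simp only [Prod.fst_add, Prod.snd_add, map_add, map_mul]; ring
  · simp only [Prod.fst_add, Prod.snd_add]; ring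

/-- The polar form is an APN form: a kernel vector of `B p` is a multiple `r • p`, and then
`r ^ (2 ^ k) + r = 0`, since otherwise `α` would be a cube. -/
theorem isAPNForm_pzForm {k s : ZMod m} {α : F} (hk : ∀ z : F, ∃ y, z * frob F k z = y ^ 3)
    (hs : ∀ z : F, ∃ y, frob F s z = z * y ^ 3) (hfix : ∀ z : F, frob F k z = z → z = 0 ∨ z = 1)
    (hα : ∀ y, y ^ 3 ≠ α) : IsAPNForm (pzForm k s α) := by
  rintro ⟨x, y⟩ ⟨u, v⟩ h
  by_cases hp : ((x, y) : F × F) = 0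
  · exact Or.inl hp
  right
  have hxy : x ≠ 0 ∨ y ≠ 0 := by
    by_contra! h
    exact hp (by rw [h.1, h.2]; rfl)
  have h1 := congrArg Prod.fst h
  have h2 := congrArg Prod.snd h
  simp only [pzForm_apply, Prod.fst_zero, Prod.snd_zero] at h1 h2
  obtain ⟨r, rfl, rfl⟩ := exists_smul_of_det (x := u) (y := v) hxy (by linear_combination h2)
  have hgold : ∀ z, goldForm k z (r * z) = (frob F k r + r) * (z * frob F k z) := fun z => by
    simp only [goldForm, map_mul]; ring
  rw [hgold, hgold] at h1
  by_cases hr : frob F k r + r = 0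
  · rcases hfix r (CharTwo.add_eq_zero.1 hr) with rfl | rfl
    · left; simp
    · right; simp
  · exfalso
    obtain ⟨ξ, hξ⟩ := hk x
    obtain ⟨η, hη⟩ := hk y
    obtain ⟨w, hw⟩ := hs (frob F k r + r)
    have hw0 : w ≠ 0 := by
      rintro rfl
      exact frob_ne_zero s hr (by rw [hw]; ring)
    rw [map_mul, hw, hξ, hη, map_pow, CharTwo.add_eq_zero] at h1
    have h3 : ξ ^ 3 = α * (w * frob F s η) ^ 3 := by
      apply mul_left_cancel₀ hr
      linear_combination h1
    have hη0 : η = 0 := by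
      by_contra hη0
      have := frob_ne_zero s hη0
      exact hα (ξ / (w * frob F s η)) (by rw [div_pow, h3]; field_simp)
    rw [hη0, map_zero] at h3
    have hξ0 : ξ = 0 := by simpa using h3
    have hzero : ∀ z : F, z * frob F k z = 0 → z = 0 := fun z hz => by simpa using hz
    rcases hxy with h | h
    · exact h (hzero x (by rw [hξ, hξ0]; ring))
    · exact h (hzero y (by rw [hη, hη0]; ring))

/-- The components that depend only on the second coordinate `x * y` are bent. -/
theorem pzForm_bent (k s : ZMod m) (α : F) (ψ : F × F →ₗ[ZMod 2] ZMod 2) (hψ : ψ ≠ 0)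
    (hψ0 : ∀ u ∈ LinearMap.range (LinearMap.inl (ZMod 2) F F), ψ u = 0) (p : F × F)
    (hp : ∀ q, ψ (pzForm k s α p q) = 0) : p = 0 := by
  have hsplit : ∀ u v, ψ (u, v) = ψ (0, v) := fun u v => by
    have h : ((u, v) : F × F) = (u, 0) + (0, v) := by simp
    rw [h, map_add, hψ0 (u, 0) ⟨u, rfl⟩, zero_add]
  have hne : ¬ ∀ w, ψ (0, w) = 0 := fun h =>
    hψ (LinearMap.ext fun ⟨u, v⟩ => by rw [hsplit, h, LinearMap.zero_apply])
  obtain ⟨x, y⟩ := p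
  simp only [pzForm_apply, hsplit] at hp
  ext
  · by_contra hx
    refine hne fun w => ?_
    have := hp (0, w / x)
    rwa [mul_div_cancel₀ _ hx, mul_zero, add_zero] at this
  · by_contra hy
    refine hne fun w => ?_
    have := hp (w / y, 0)
    rwa [mul_div_cancel₀ _ hy, mul_zero, zero_add] at this

variable [NeZero m]

/-- The values of the polar form span `F × F`. -/
theorem pzForm_span (hF : Nat.card F = 2 ^ m) {k s : ZMod m} (hkk : k + k ≠ 0) {α : F}
    (ψ : F × F →ₗ[ZMod 2] ZMod 2) (hψ : ∀ p q, ψ (pzForm k s α p q) = 0) : ψ = 0 := by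
  have h2 : ∀ v, ψ (0, v) = 0 := fun v => by
    have := hψ (1, 0) (0, v)
    simpa [pzForm_apply, goldForm_zero_right, goldForm_zero_left] using this
  have h1 : ∀ u, ψ (u, 0) = 0 := by
    obtain ⟨n, hn⟩ := exists_linPoly hF
      (Algebra.linearMap (ZMod 2) F ∘ₗ ψ ∘ₗ LinearMap.inl (ZMod 2) F F)
    have hzero : ∀ x u, linPoly₂ (goldCoeff k n) x u = linPoly₂ (fun _ _ : ZMod m => 0) x u := by
      intro x u
      rw [← linPoly_goldForm hF, ← hn]
      have := hψ (x, 0) (u, 0)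
      simp only [pzForm_apply, goldForm_zero_right, map_zero, mul_zero, add_zero, zero_mul] at this
      simp [this, linPoly₂]
    have hn0 : n = 0 := funext fun j => by
      have := linPoly₂_congr hF hzero (j + k) j
      have hj : j ≠ j + k + k := fun h => hkk (by linear_combination -h)
      simpa [goldCoeff, hj] using this
    intro u
    have := hn u
    rw [hn0] at this
    simpa [linPoly] using this
  refine LinearMap.ext fun ⟨u, v⟩ => ?_
  have h : ((u, v) : F × F) = (u, 0) + (0, v) := by simp
  rw [h, map_add, h1, h2]
  rfl

/-- Linear equivalence of the polar forms of `f_{k,s,α}` and `f_{l,t,β}` forces `k = l` and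
`s = ± t`. -/
theorem index_eq_of_polar_equiv (hF : Nat.card F = 2 ^ m) {π : ZMod m →+* ZMod 2}
    {k l s t : ZMod m} {α β : F}
    (hk1 : π k = 1) (hl1 : π l = 1) (hs0 : π s = 0) (ht0 : π t = 0) (hkk : k + k ≠ 0)
    (hll : l + l ≠ 0) (hkl : k + l ≠ 0) (hkl2 : k ≠ l → k + k ≠ l + l)
    (hklt : k = l → t + t = 0 → t = 0) (hl : ∀ z : F, ∃ y, z * frob F l z = y ^ 3)
    (hα : α ≠ 0) (hβ : ∀ y, y ^ 3 ≠ β) {A N : F × F →ₗ[ZMod 2] F × F}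
    (hA : Function.Injective A)
    (hN : ∀ p q, N (pzForm k s α p q) = pzForm l t β (A p) (A q)) :
    k = l ∧ (s = t ∨ s + t = 0) := by
  have hfin : Finite F := Nat.finite_of_card_ne_zero (by rw [hF]; positivity)
  let inl := LinearMap.inl (ZMod 2) F F
  let inr := LinearMap.inr (ZMod 2) F F
  let fst := LinearMap.fst (ZMod 2) F F
  let snd := LinearMap.snd (ZMod 2) F F
  obtain ⟨a, ha⟩ := exists_linPoly hF (fst ∘ₗ A ∘ₗ inl)
  obtain ⟨b, hb⟩ := exists_linPoly hF (fst ∘ₗ A ∘ₗ inr)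
  obtain ⟨c, hc⟩ := exists_linPoly hF (snd ∘ₗ A ∘ₗ inl)
  obtain ⟨d, hd⟩ := exists_linPoly hF (snd ∘ₗ A ∘ₗ inr)
  obtain ⟨n₁₁, hn₁₁⟩ := exists_linPoly hF (fst ∘ₗ N ∘ₗ inl)
  obtain ⟨n₁₂, hn₁₂⟩ := exists_linPoly hF (fst ∘ₗ N ∘ₗ inr)
  obtain ⟨n₂₁, hn₂₁⟩ := exists_linPoly hF (snd ∘ₗ N ∘ₗ inl)
  obtain ⟨n₂₂, hn₂₂⟩ := exists_linPoly hF (snd ∘ₗ N ∘ₗ inr)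
  have hAl : ∀ x, A (x, 0) = (linPoly a x, linPoly c x) := fun x => Prod.ext (ha x) (hc x)
  have hAr : ∀ y, A (0, y) = (linPoly b y, linPoly d y) := fun y => Prod.ext (hb y) (hd y)
  have hNl : ∀ x, N (x, 0) = (linPoly n₁₁ x, linPoly n₂₁ x) := fun x =>
    Prod.ext (hn₁₁ x) (hn₂₁ x)
  have hNr : ∀ x, N (0, x) = (linPoly n₁₂ x, linPoly n₂₂ x) := fun x =>
    Prod.ext (hn₁₂ x) (hn₂₂ x)
  have hxu : ∀ x u, (linPoly₂ (goldCoeff k n₁₁) x u, linPoly₂ (goldCoeff k n₂₁) x u) =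
      (linPoly₂ (formCoeff l t β a a c c) x u,
        linPoly₂ (fun i j => a i * c j + c i * a j) x u) := fun x u => by
    have h := hN (x, 0) (u, 0)
    simp only [hAl, pzForm_apply, goldForm_zero_right, map_zero, mul_zero, zero_mul, add_zero, hNl,
      linPoly_goldForm hF, goldForm_add_linPoly hF, linPoly_mul_linPoly, linPoly₂_add] at h
    exact h
  have hyv : ∀ y v, (linPoly₂ (goldCoeff k fun j => n₁₁ (j - s) * frob F (j - s) α) y v,
      linPoly₂ (goldCoeff k fun j => n₂₁ (j - s) * frob F (j - s) α) y v) =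
      (linPoly₂ (formCoeff l t β b b d d) y v,
        linPoly₂ (fun i j => b i * d j + d i * b j) y v) := fun y v => by
    have h := hN (0, y) (0, v)
    simp only [hAr, pzForm_apply, goldForm_zero_right, mul_zero, zero_mul, add_zero, zero_add, hNl,
      linPoly_mul_frob hF, linPoly_goldForm hF, goldForm_add_linPoly hF, linPoly_mul_linPoly,
      linPoly₂_add] at h
    exact h
  have hxv : ∀ x v, (linPoly₂ (fun i j => if i = j then n₁₂ j else 0) x v,
      linPoly₂ (fun i j => if i = j then n₂₂ j else 0) x v) =
      (linPoly₂ (formCoeff l t β a b c d) x v,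
        linPoly₂ (fun i j => a i * d j + c i * b j) x v) := fun x v => by
    have h := hN (x, 0) (0, v)
    simp only [hAl, hAr, pzForm_apply, goldForm_zero_right, goldForm_zero_left, map_zero, mul_zero,
      add_zero, hNr, linPoly_mul, goldForm_add_linPoly hF, linPoly_mul_linPoly,
      linPoly₂_add] at h
    exact h
  have hsurj : Function.Surjective A := Finite.surjective_of_injective hA
  have hAz : ∀ x y, A (x, y) = (linPoly a x + linPoly b y, linPoly c x + linPoly d y) :=
    fun x y => by
      have h : ((x, y) : F × F) = (x, 0) + (0, y) := by simp
      rw [h, map_add, hAl, hAr]; rfl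
  have hlin : ∀ (p q : F) (a c : ZMod m → F), (∀ i, p * a i + q * c i = 0) →
      ∀ x, p * linPoly a x + q * linPoly c x = 0 := fun p q a c h x => by
    simp only [linPoly, Finset.mul_sum, ← Finset.sum_add_distrib]
    exact Finset.sum_eq_zero fun i _ => by linear_combination frob F i x * h i
  refine index_eq_of_coeff hk1 hl1 hs0 ht0 hkk hll hkl hkl2 hklt hl hβ ?_ ?_ (fun p q hp hq => ?_)
    (fun i j hij => ?_) (fun i j h1 h2 => ?_) (fun i j h1 h2 => ?_) (fun i j hij => ?_)
    (fun i j => (linPoly₂_congr hF (fun x u => congrArg Prod.fst (hxu x u)) i j).symm)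
    (fun i j => (linPoly₂_congr hF (fun y v => congrArg Prod.fst (hyv y v)) i j).symm)
    (fun j hj => mul_ne_zero hj (frob_ne_zero _ hα))
  · by_contra! h
    have h0 : A (1, 0) = A 0 := by
      rw [hAl, map_zero]
      ext <;> simp [linPoly, h]
    simpa using hA h0
  · by_contra! h
    have h0 : A (0, 1) = A 0 := by
      rw [hAr, map_zero]
      ext <;> simp [linPoly, h]
    simpa using hA h0
  · have hall : ∀ w : F × F, p * w.1 + q * w.2 = 0 := fun w => by
      obtain ⟨⟨x, y⟩, rfl⟩ := hsurj w
      rw [hAz]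
      linear_combination hlin p q a c hp x + hlin p q b d hq y
    exact ⟨by simpa using hall (1, 0), by simpa using hall (0, 1)⟩
  · have := linPoly₂_congr hF (fun x v => congrArg Prod.snd (hxv x v)) i j
    rwa [if_neg hij, eq_comm] at this
  · have := linPoly₂_congr hF (fun x u => congrArg Prod.snd (hxu x u)) i j
    rwa [goldCoeff, if_neg h1, if_neg h2, add_zero, eq_comm] at this
  · have := linPoly₂_congr hF (fun y v => congrArg Prod.snd (hyv y v)) i j
    rwa [goldCoeff, if_neg h1, if_neg h2, add_zero, eq_comm] at this
  · have := linPoly₂_congr hF (fun x v => congrArg Prod.fst (hxv x v)) i j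
    rwa [if_neg hij, eq_comm] at this

end PottZhou

/-! ### Pairwise inequivalence -/

section Inequivalence

open Module

variable {F : Type*} [Field F] {m : ℕ}

theorem exists_pow_two_pow_mul_eq_cube {k : ℕ} (hk : Odd k) (z : F) :
    ∃ y, z * z ^ 2 ^ k = y ^ 3 := by
  obtain ⟨q, hq⟩ : 3 ∣ 2 ^ k + 1 ^ k := hk.nat_add_dvd_pow_add_pow 2 1
  rw [one_pow] at hq
  exact ⟨z ^ q, by rw [← pow_succ', hq, ← pow_mul, mul_comm]⟩

theorem exists_pow_two_pow_eq_mul_cube {s : ℕ} (hs : Even s) (z : F) :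
    ∃ y, z ^ 2 ^ s = z * y ^ 3 := by
  obtain ⟨j, rfl⟩ := hs
  obtain ⟨q, hq⟩ : 3 ∣ 4 ^ j - 1 ^ j := Nat.sub_dvd_pow_sub_pow 4 1 j
  have h1 : 1 ≤ 4 ^ j := Nat.one_le_pow _ _ (by norm_num)
  have h2 : 2 ^ (j + j) = q * 3 + 1 := by
    rw [← two_mul, pow_mul]
    norm_num at hq ⊢
    omega
  exact ⟨z ^ q, by rw [h2, pow_succ, pow_mul, mul_comm]⟩

theorem exists_non_cube (hm : Even m) (hF : Nat.card F = 2 ^ m) : ∃ α : F, ∀ y, y ^ 3 ≠ α := by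
  have hfin : Finite F := Nat.finite_of_card_ne_zero (by rw [hF]; positivity)
  have := Fintype.ofFinite F
  by_contra! h
  have hinj : Function.Injective fun y : F => y ^ 3 := Finite.injective_iff_surjective.2 h
  obtain ⟨j, rfl⟩ := hm
  have hdvd : 3 ∣ Nat.card Fˣ := by
    have h3 : 4 - 1 ∣ 4 ^ j - 1 ^ j := Nat.sub_dvd_pow_sub_pow 4 1 j
    rw [Nat.card_units, hF, ← two_mul, pow_mul]
    simpa using h3
  have : Fact (Nat.Prime 3) := ⟨Nat.prime_three⟩
  obtain ⟨u, hu⟩ := exists_prime_orderOf_dvd_card' 3 hdvd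
  have h1 : (u : F) ^ 3 = 1 ^ 3 := by
    rw [one_pow, ← Units.val_pow_eq_pow_val, ← hu, pow_orderOf_eq_one, Units.val_one]
  have h2 : u = 1 := Units.ext (hinj h1)
  rw [h2, orderOf_one] at hu
  omega

theorem natCast_ne_zero_of_lt {j : ℕ} (h0 : 0 < j) (hj : j < m) : (j : ZMod m) ≠ 0 := by
  rw [Ne, ZMod.natCast_eq_zero_iff]
  exact Nat.not_dvd_of_pos_of_lt h0 hj

theorem natCast_inj_of_lt {i j : ℕ} (hi : i < m) (hj : j < m) (h : (i : ZMod m) = j) : i = j := by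
  rwa [ZMod.natCast_eq_natCast_iff', Nat.mod_eq_of_lt hi, Nat.mod_eq_of_lt hj] at h

variable [CharP F 2]

theorem eq_zero_or_one_of_pow (hF : Nat.card F = 2 ^ m) {k : ℕ} (hk : Nat.Coprime k m) {z : F}
    (hz : z ^ 2 ^ k = z) : z = 0 ∨ z = 1 := by
  have hfin : Finite F := Nat.finite_of_card_ne_zero (by rw [hF]; positivity)
  have := Fintype.ofFinite F
  have h1 : Function.IsPeriodicPt (frobenius F 2) k z := by
    rw [Function.IsPeriodicPt, Function.IsFixedPt, iterate_frobenius, hz]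
  have h2 : Function.IsPeriodicPt (frobenius F 2) m z := by
    rw [Function.IsPeriodicPt, Function.IsFixedPt, iterate_frobenius, ← hF,
      Nat.card_eq_fintype_card, FiniteField.pow_card]
  have h3 := h1.gcd h2
  rw [hk.gcd_eq_one, Function.IsPeriodicPt, Function.IsFixedPt, iterate_frobenius, pow_one] at h3
  by_cases h0 : z = 0
  · exact Or.inl h0
  · right
    apply mul_left_cancel₀ h0
    linear_combination h3

variable [Algebra (ZMod 2) F]

theorem isAPNForm_of_nat (hm : Even m) (hF : Nat.card F = 2 ^ m) {k s : ℕ}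
    (hk : Nat.Coprime k m) (hs : Even s) {α : F} (hα : ∀ y, y ^ 3 ≠ α) :
    IsAPNForm (pzForm (k : ZMod m) (s : ZMod m) α) := by
  have hkodd : Odd k := Nat.Coprime.odd_of_right (Nat.Coprime.coprime_dvd_right hm.two_dvd hk)
  refine isAPNForm_pzForm (fun z => ?_) (fun z => ?_) (fun z hz => ?_) hα
  · rw [frob_natCast hF]
    exact exists_pow_two_pow_mul_eq_cube hkodd z
  · rw [frob_natCast hF]
    exact exists_pow_two_pow_eq_mul_cube hs z
  · rw [frob_natCast hF] at hz
    exact eq_zero_or_one_of_pow hF hk hz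

/-- Inequivalence for ordered second parameters. The order excludes the exceptional case `k = l`,
`t = m / 2`, in which cancellations occur for `m = 4`. -/
theorem pottZhou_inequivalent_of_le (hm : Even m) (hm4 : 4 ≤ m) (hF : Nat.card F = 2 ^ m)
    {k l s t : ℕ} (hk : Nat.Coprime k m) (hl : Nat.Coprime l m) (hkm : 2 * k < m)
    (hlm : 2 * l < m) (hs : Even s) (ht : Even t) (hsm : 2 * s ≤ m) (hts : t ≤ s) {α : F}
    (hα : ∀ y, y ^ 3 ≠ α) (h : CCZEquivalent (pottZhou k s α) (pottZhou l t α)) :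
    k = l ∧ s = t := by
  have : NeZero m := ⟨by omega⟩
  have hfin : Finite F := Nat.finite_of_card_ne_zero (by rw [hF]; positivity)
  have hodd : ∀ {k}, Nat.Coprime k m → Odd k := fun hk =>
    Nat.Coprime.odd_of_right (Nat.Coprime.coprime_dvd_right hm.two_dvd hk)
  have hα0 : α ≠ 0 := fun h => hα 0 (by rw [h]; ring)
  have hdim : finrank (ZMod 2) F = m := by
    have h1 := Module.natCard_eq_pow_finrank (K := ZMod 2) (V := F)
    rw [hF, Nat.card_zmod] at h1
    exact (Nat.pow_right_injective le_rfl h1).symm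
  -- from here on, `k = l` implies `t < s ≤ m / 2`
  by_contra hne
  have hkpos := (hodd hk).pos
  have hlpos := (hodd hl).pos
  have hkk : (k : ZMod m) + k ≠ 0 := by
    exact_mod_cast natCast_ne_zero_of_lt (m := m) (j := k + k) (by omega) (by omega)
  have hll : (l : ZMod m) + l ≠ 0 := by
    exact_mod_cast natCast_ne_zero_of_lt (m := m) (j := l + l) (by omega) (by omega)
  have hkl : (k : ZMod m) + l ≠ 0 := by
    exact_mod_cast natCast_ne_zero_of_lt (m := m) (j := k + l) (by omega) (by omega)
  obtain ⟨A, N, hA, hN⟩ := exists_polar_equiv_of_ccz (m := m) (by omega)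
    (by rw [Module.finrank_prod, hdim]; omega) (hasPolar_pottZhou hF k s α)
    (isAPNForm_of_nat hm hF hk hs hα) (hasPolar_pottZhou hF l t α)
    (isAPNForm_of_nat hm hF hl ht hα)
    (by rw [LinearMap.finrank_range_of_inj LinearMap.inl_injective, hdim])
    (pzForm_bent _ _ α) (pzForm_span hF hkk) h
  let π : ZMod m →+* ZMod 2 := ZMod.castHom hm.two_dvd (ZMod 2)
  have hπodd : ∀ {j : ℕ}, Odd j → π (j : ZMod m) = 1 := fun hj => by
    rw [map_natCast]; exact ZMod.natCast_eq_one_iff_odd.2 hj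
  have hπeven : ∀ {j : ℕ}, Even j → π (j : ZMod m) = 0 := fun hj => by
    rw [map_natCast]; exact ZMod.natCast_eq_zero_iff_even.2 hj
  obtain ⟨h1, h2⟩ := index_eq_of_polar_equiv hF (hπodd (hodd hk)) (hπodd (hodd hl)) (hπeven hs)
    (hπeven ht) hkk hll hkl
    (fun hne h => hne (by
      have h' : ((k + k : ℕ) : ZMod m) = ((l + l : ℕ) : ZMod m) := by exact_mod_cast h
      have := natCast_inj_of_lt (by omega) (by omega) h'
      rw [show k = l by omega]))
    (fun hkl h0 => by
      have hkl' := natCast_inj_of_lt (by omega) (by omega) hkl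
      by_contra ht0
      have htpos : 0 < t := Nat.pos_of_ne_zero (by rintro rfl; simp at ht0)
      have h' : ((t + t : ℕ) : ZMod m) = 0 := by exact_mod_cast h0
      exact natCast_ne_zero_of_lt (by omega) (by omega) h')
    (fun z => by
      rw [frob_natCast hF]
      exact exists_pow_two_pow_mul_eq_cube (hodd hl) z) hα0 hα hA hN
  have hkl' := natCast_inj_of_lt (by omega) (by omega) h1
  rcases h2 with h2 | h2
  · exact hne ⟨hkl', natCast_inj_of_lt (by omega) (by omega) h2⟩
  · have h' : ((s + t : ℕ) : ZMod m) = 0 := by exact_mod_cast h2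
    exact natCast_ne_zero_of_lt (by omega) (by omega) h'

theorem pottZhou_inequivalent (hm : Even m) (hm4 : 4 ≤ m) (hF : Nat.card F = 2 ^ m)
    {k l s t : ℕ} (hk : Nat.Coprime k m) (hl : Nat.Coprime l m) (hkm : 2 * k < m)
    (hlm : 2 * l < m) (hs : Even s) (ht : Even t) (hsm : 2 * s ≤ m) (htm : 2 * t ≤ m) {α : F}
    (hα : ∀ y, y ^ 3 ≠ α) (h : CCZEquivalent (pottZhou k s α) (pottZhou l t α)) :
    k = l ∧ s = t := by
  rcases le_total t s with hts | hst
  · exact pottZhou_inequivalent_of_le hm hm4 hF hk hl hkm hlm hs ht hsm hts hα h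
  · obtain ⟨h1, h2⟩ :=
      pottZhou_inequivalent_of_le hm hm4 hF hl hk hlm hkm ht hs htm hst hα h.symm
    exact ⟨h1.symm, h2.symm⟩

end Inequivalence

/-! ### Transport and counting -/

section Counting

theorem IsAPN.conj {V W : Type*} [AddCommGroup V] [AddCommGroup W] {f : V → V} (hf : IsAPN f)
    (e : V ≃+ W) : IsAPN fun z => e (f (e.symm z)) := by
  intro a b ha
  have h : {z | e (f (e.symm (z + a))) + e (f (e.symm z)) = b} =
      e '' {x | f (x + e.symm a) + f x = e.symm b} := by
    ext z
    constructor
    · intro hz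
      refine ⟨e.symm z, ?_, e.apply_symm_apply z⟩
      rw [Set.mem_ofPred_eq] at hz ⊢
      rw [← hz, map_add, map_add, e.symm_apply_apply, e.symm_apply_apply]
    · rintro ⟨x, hx, rfl⟩
      rw [Set.mem_ofPred_eq] at hx ⊢
      rw [map_add, e.symm_apply_apply, ← map_add, hx, e.apply_symm_apply]
  rw [h, e.injective.encard_image]
  exact hf _ _ (by simpa using ha)

theorem CCZEquivalent.of_conj {V W : Type*} [AddCommGroup V] [Module (ZMod 2) V]
    [AddCommGroup W] [Module (ZMod 2) W] {f g : V → V} (e : V ≃ₗ[ZMod 2] W)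
    (h : CCZEquivalent (fun z => e (f (e.symm z))) fun z => e (g (e.symm z))) :
    CCZEquivalent f g := by
  obtain ⟨C, hC⟩ := h
  let D : (V × V) ≃ᵃ[ZMod 2] (W × W) := (e.prodCongr e).toAffineEquiv
  have hD : ∀ f : V → V, D '' Set.range (fun x => (x, f x)) =
      Set.range fun z => (z, e (f (e.symm z))) := fun f => by
    rw [← Set.range_comp, ← e.surjective.range_comp]
    congr 1
    funext x
    simp [D]
  refine ⟨(D.trans C).trans D.symm, ?_⟩
  have h1 : ∀ S : Set (V × V), ((D.trans C).trans D.symm) '' S = D.symm '' (C '' (D '' S)) :=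
    fun S => by
      rw [Set.image_image, Set.image_image]
      rfl
  rw [h1, hD, hC, ← hD, Set.image_image]
  simp

/-- The involution `k ↦ m - k` pairs the units below `m / 2` with those above it. -/
theorem card_coprime_lt_half {m : ℕ} (hm : Even m) (hm4 : 4 ≤ m) :
    ((Finset.range m).filter fun k => k.Coprime m ∧ 2 * k < m).card = m.totient / 2 := by
  have h1 : ((Finset.range m).filter fun k => k.Coprime m ∧ ¬ 2 * k < m).card =
      ((Finset.range m).filter fun k => k.Coprime m ∧ 2 * k < m).card := by
    have hhalf : ∀ k, k.Coprime m → 2 * k ≠ m := by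
      rintro k hk rfl
      have : k = 1 := Nat.Coprime.eq_one_of_dvd hk (Dvd.intro_left 2 rfl)
      omega
    have hpos : ∀ k, k.Coprime m → 0 < k := by
      intro k hk
      rcases Nat.eq_zero_or_pos k with rfl | h
      · rw [Nat.coprime_zero_left] at hk
        omega
      · exact h
    have hsub : ∀ k, k < m → k.Coprime m → (m - k).Coprime m := fun k hk h =>
      ((Nat.coprime_self_sub_left hk.le).2 h)
    refine Finset.card_nbij' (fun k => m - k) (fun k => m - k) ?_ ?_ ?_ ?_
    all_goals
      intro k hk
      simp only [Finset.coe_filter, Finset.mem_range, Set.mem_ofPred_eq] at hk ⊢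
      have := hhalf k hk.2.1
      have := hpos k hk.2.1
      have := hsub k hk.1 hk.2.1
      omega
  have h2 : m.totient = ((Finset.range m).filter fun k => k.Coprime m).card := by
    rw [Nat.totient]
    congr 1
    exact Finset.filter_congr fun k _ => Nat.coprime_comm
  rw [h2, ← Finset.card_filter_add_card_filter_not (s := (Finset.range m).filter fun k =>
    k.Coprime m) (fun k => 2 * k < m), Finset.filter_filter, Finset.filter_filter, h1]
  omega

end Counting

theorem corollary2 (m : ℕ) (hm : Even m) (hm4 : 4 ≤ m)
    {F : Type*} [Field F] [Algebra (ZMod 2) F] (hF : Nat.card F = 2 ^ m)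
    {K : Type*} [Field K] [Algebra (ZMod 2) K] (hK : Nat.card K = 2 ^ (2 * m)) :
    Nonempty ((F × F) ≃ₗ[ZMod 2] K) ∧
    (∀ e : (F × F) ≃ₗ[ZMod 2] K, ∃ S : Finset (K → K),
      S.card = (m / 4 + 1) * (Nat.totient m / 2) ∧
      (∀ f ∈ S, IsPottZhou m e f ∧ IsAPN f) ∧
      (∀ f ∈ S, ∀ g ∈ S, f ≠ g → ¬ CCZEquivalent f g)) ∧
    (m / 4 + 1) * (Nat.totient m / 2) ≤ numAPNClasses K := by
  classical
  have : CharP F 2 := charP_of_injective_algebraMap (algebraMap (ZMod 2) F).injective 2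
  have hfinF : Finite F := Nat.finite_of_card_ne_zero (by rw [hF]; positivity)
  have hfinK : Finite K := Nat.finite_of_card_ne_zero (by rw [hK]; positivity)
  have hdim : Nonempty ((F × F) ≃ₗ[ZMod 2] K) := by
    refine FiniteDimensional.nonempty_linearEquiv_of_finrank_eq ?_
    have h1 := Module.natCard_eq_pow_finrank (K := ZMod 2) (V := F × F)
    have h2 := Module.natCard_eq_pow_finrank (K := ZMod 2) (V := K)
    rw [Nat.card_prod, hF, ← pow_add, ← two_mul, ← hK, h2] at h1
    rw [Nat.card_zmod] at h1
    exact (Nat.pow_right_injective le_rfl h1).symm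
  obtain ⟨α, hα⟩ := exists_non_cube hm hF
  have hα0 : α ≠ 0 := fun h => hα 0 (by rw [h]; ring)
  have key : ∀ e : (F × F) ≃ₗ[ZMod 2] K, ∃ S : Finset (K → K),
      S.card = (m / 4 + 1) * (Nat.totient m / 2) ∧
      (∀ f ∈ S, IsPottZhou m e f ∧ IsAPN f) ∧
      (∀ f ∈ S, ∀ g ∈ S, f ≠ g → ¬ CCZEquivalent f g) := by
    intro e
    let I : Finset (ℕ × ℕ) := Finset.range (m / 4 + 1) ×ˢ
      (Finset.range m).filter fun k => k.Coprime m ∧ 2 * k < m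
    let Φ : ℕ × ℕ → K → K := fun p z => e (pottZhou p.2 (2 * p.1) α (e.symm z))
    have hI : ∀ p ∈ I, p.1 < m / 4 + 1 ∧ p.2.Coprime m ∧ 2 * p.2 < m := fun p hp => by
      simp only [I, Finset.mem_product, Finset.mem_range, Finset.mem_filter] at hp
      exact ⟨hp.1, hp.2.2⟩
    have hne : ∀ p ∈ I, ∀ q ∈ I, CCZEquivalent (Φ p) (Φ q) → p = q := by
      intro p hp q hq h
      obtain ⟨hp1, hp2, hp3⟩ := hI p hp
      obtain ⟨hq1, hq2, hq3⟩ := hI q hq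
      obtain ⟨h1, h2⟩ := pottZhou_inequivalent hm hm4 hF hp2 hq2 hp3 hq3 (even_two_mul p.1)
        (even_two_mul q.1) (by omega) (by omega) hα (h.of_conj e)
      exact Prod.ext (by omega) h1
    refine ⟨I.image Φ, ?_, ?_, ?_⟩
    · rw [Finset.card_image_of_injOn fun p hp q hq h => hne p hp q hq (by
          rw [h]; exact CCZEquivalent.refl _),
        Finset.card_product, Finset.card_range, card_coprime_lt_half hm hm4]
    · intro f hf
      obtain ⟨p, hp, rfl⟩ := Finset.mem_image.1 hf
      obtain ⟨hp1, hp2, hp3⟩ := hI p hp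
      exact ⟨⟨p.2, 2 * p.1, α, by omega, by omega, hp2, even_two_mul _, hα0,
        fun ⟨β, hβ⟩ => hα β hβ, fun _ => rfl⟩,
        ((hasPolar_pottZhou hF _ _ α).isAPN
          (isAPNForm_of_nat hm hF hp2 (even_two_mul _) hα)).conj e.toAddEquiv⟩
    · intro f hf g hg hfg h
      obtain ⟨p, hp, rfl⟩ := Finset.mem_image.1 hf
      obtain ⟨q, hq, rfl⟩ := Finset.mem_image.1 hg
      exact hfg (congrArg Φ (hne p hp q hq h))
  refine ⟨hdim, key, ?_⟩
  obtain ⟨e⟩ := hdim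
  obtain ⟨S, hcard, hS, hineq⟩ := key e
  let Ψ : S → Quotient (apnSetoid K) := fun f => Quotient.mk _ ⟨f.1, (hS f.1 f.2).2⟩
  have hinj : Function.Injective Ψ := fun f g h => by
    by_contra hfg
    exact hineq f f.2 g g.2 (fun h => hfg (Subtype.ext h)) (Quotient.exact h)
  rw [← hcard, numAPNClasses]
  have := Nat.card_le_card_of_injective Ψ hinj
  simpa using this
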